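/- Let $a<b$ be real, $q,n\ge 0$ integers, and $(s_k)$ a sequence of complex $q\times q$ matrices; write $I$ for identity matrices and ${}^*$ for the conjugate transpose, and $F^*(w):=(F(w))^*$ for a matrix function $F$. **Block matrices.** For $j\ge0$ put $\widetilde H_{r,j}=(s_{l+k+r})_{l,k=0}^{j}$ and $$H_{1,j}=\widetilde H_{0,j},\quad H_{2,j}=-ab\widetilde H_{0,j}+(a+b)\widetilde H_{1,j}-\widetilde H_{2,j},\quad K_{1,j}=b\widetilde H_{0,j}-\widetilde H_{1,j},\quad K_{2,j}=-a\widetilde H_{0,j}+\widetilde H_{1,j}.$$ The sequence $(s_k)_{k=0}^{2n}$ is called Hausdorff positive definite if $H_{1,n}$ and (when $n\ge1$) $H_{2,n-1}$ are positive definite; $(s_k)_{k=0}^{2n+1}$ is called so if $K_{1,n}$ and $K_{2,n}$ are positive definite. Let $T_j$ be the $(j+1)q\times(j+1)q$ matrix with blocks $I_q$ on the first block subdiagonal and zeros elsewhere, $R_j(z)=(I-zT_j)^{-1}$, $\widehat s_j=-abs_j+(a+b)s_{j+1}-s_{j+2}$, and define the block columns with $j+1$ blocks $$v_j=\begin{pmatrix}I_q\\0\\\vdots\\0\end{pmatrix},\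 u_{1,j}=\begin{pmatrix}0\\-s_0\\\vdots\\-s_{j-1}\end{pmatrix},\ u_{2,j}=\begin{pmatrix}-(a+b)s_0+s_1\\-\widehat s_0\\\vdots\\-\widehat s_{j-1}\end{pmatrix},\ \widetilde u_{1,j}=\begin{pmatrix}s_0\\s_1-bs_0\\\vdots\\s_j-bs_{j-1}\end{pmatrix},\ \widetilde u_{2,j}=\begin{pmatrix}-s_0\\-s_1+as_0\\\vdots\\-s_j+as_{j-1}\end{pmatrix}.$$ For $j\ge1$ let $Y_{1,j},Y_{2,j},\widetilde Y_{1,j},\widetilde Y_{2,j}$ be the block columns with the $j$ blocks $s_i$, $\widehat s_i$, $bs_i-s_{i+1}$, $-as_i+s_{i+1}$ ($j\le i\le 2j-1$), respectively. **Polynomials.** $P_{1,0}=P_{2,0}=\Gamma_{1,0}=\Gamma_{2,0}=I_q$, $Q_{1,0}=0$, $Q_{2,0}(z)=-(u_{2,0}+zs_0)$, $\Theta_{1,0}=s_0$, $\Theta_{2,0}=-s_0$, and for $j\ge1$, $k=1,2$, $$P_{k,j}(z)=(-Y_{k,j}^*H_{k,j-1}^{-1},I_q)R_j(z)v_j,\qquad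 Q_{1,j}(z)=-(-Y_{1,j}^*H_{1,j-1}^{-1},I_q)R_j(z)u_{1,j},$$ $$Q_{2,j}(z)=-(-Y_{2,j}^*H_{2,j-1}^{-1},I_q)R_j(z)(u_{2,j}+zv_js_0),$$ $$\Gamma_{k,j}(z)=(-\widetilde Y_{k,j}^*K_{k,j-1}^{-1},I_q)R_j(z)v_j,\qquad \Theta_{k,j}(z)=(-\widetilde Y_{k,j}^*K_{k,j-1}^{-1},I_q)R_j(z)\widetilde u_{k,j}.$$ **Dyukarev--Stieltjes matrix (DSM) parameters.** Put $$\lambda_j=(u_{2,j}^*+as_0v_j^*)R_j^*(a)H_{2,j}^{-1}R_j(a)(u_{2,j}+av_js_0),\qquad \mu_j=v_j^*R_j^*(a)K_{1,j}^{-1}R_j(a)v_j,$$ $$M'_j=v_j^*R_j^*(a)H_{1,j}^{-1}R_j(a)v_j,\qquad L'_j=\widetilde u_{2,j}^*R_j^*(a)K_{2,j}^{-1}R_j(a)\widetilde u_{2,j},$$ and $\mathbf l_0=\lambda_0$, $\mathbf m_0=\mu_0$, $\mathbf M_0=s_0^{-1}$, $\mathbf L_0=L'_0$, and for $j\ge1$: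 $\mathbf l_j=\lambda_j-\lambda_{j-1}$, $\mathbf m_j=\mu_j-\mu_{j-1}$, $\mathbf M_j=M'_j-M'_{j-1}$, $\mathbf L_j=L'_j-L'_{j-1}$. **Theorem.** Write $\frac AB=AB^{-1}$ for $B$ invertible, and let $z\in\mathbb C\setminus[a,b]$. (a) If $(s_k)_{k=0}^{2n}$ is Hausdorff positive definite, then the even Friedrichs and Krein extremal solutions are given by $$\frac{\Theta_{1,n}^*(\bar z)}{(b-z)\Gamma_{1,n}^*(\bar z)}=\frac{s_0}{b-z}+\cfrac{I_q}{-(z-a)(b-z)\mathbf m_0+\cfrac{I_q}{\frac1{b-z}\mathbf l_0+\cfrac{I_q}{\ddots\;-(z-a)(b-z)\mathbf m_{n-1}+\cfrac{I_q}{\frac1{b-z}\mathbf l_{n-1}}}}},$$ $$\frac{\Theta_{2,n}^*(\bar z)}{(z-a)\Gamma_{2,n}^*(\bar z)}=\cfrac{I_q}{-(z-a)\mathbf M_0+\cfrac{I_q}{\mathbf L_0+\cfrac{I_q}{\ddots\;+\mathbf L_{n-1}+\cfrac{I_q}{-(z-a)\mathbf M_n}}}}.$$ (b) If $(s_k)_{k=0}^{2n+1}$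 is Hausdorff positive definite, then the odd Friedrichs and Krein extremal solutions are given by $$-\frac{Q_{1,n+1}^*(\bar z)}{P_{1,n+1}^*(\bar z)}=\cfrac{I_q}{-(z-a)\mathbf M_0+\cfrac{I_q}{\mathbf L_0+\cfrac{I_q}{\ddots\;+\mathbf L_{n-1}+\cfrac{I_q}{-(z-a)\mathbf M_n+\mathbf L_n^{-1}}}}},$$ $$-\frac{Q_{2,n}^*(\bar z)}{(z-a)(b-z)P_{2,n}^*(\bar z)}=\frac{s_0}{b-z}+\cfrac{I_q}{-(z-a)(b-z)\mathbf m_0+\cfrac{I_q}{\frac1{b-z}\mathbf l_0+\cfrac{I_q}{\ddots\;\frac1{b-z}\mathbf l_{n-1}+\cfrac{I_q}{-(z-a)(b-z)\mathbf m_n}}}}.$$ In each of the four identities all denominators, on the left and at every level of the continued fraction on the right, are invertible. (For $n=0$ the first fraction is just $\frac{s_0}{b-z}$, the second $\frac{I_q}{-(z-a)\mathbf M_0}$, the third $\frac{I_q}{-(z-a)\mathbf M_0+\mathbf L_0^{-1}}$, and the fourth $\frac{s_0}{b-z}+\frac{I_q}{-(z-a)(b-z)\mathbf m_0}$.) -/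

import Mathlib

open scoped ComplexOrder Matrix

noncomputable section

namespace THMM

variable {q : ℕ}

/-- The complex `q × q` matrices. -/
abbrev Mat (q : ℕ) : Type := Matrix (Fin q) (Fin q) ℂ

/-- The complex `(j+1)q × (j+1)q` matrices, indexed by (block index, index inside the block). -/
abbrev BlockMat (q j : ℕ) : Type := Matrix (Fin (j + 1) × Fin q) (Fin (j + 1) × Fin q) ℂ

/-- Block columns of `j+1` blocks of size `q × q`. -/
abbrev BlockCol (q j : ℕ) : Type := Matrix (Fin (j + 1) × Fin q) (Fin q) ℂ

/-- Block rows of `j+1` blocks of size `q × q`. -/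
abbrev BlockRow (q j : ℕ) : Type := Matrix (Fin q) (Fin (j + 1) × Fin q) ℂ

/-- The block column with blocks `c 0, …, c j`. -/
def blockCol (c : ℕ → Mat q) (j : ℕ) : BlockCol q j :=
  Matrix.of fun i k => c i.1 i.2 k

/-- The block Hankel matrix `(s_{l+k+r})_{l,k=0}^j`. -/
def hankel (s : ℕ → Mat q) (r j : ℕ) : BlockMat q j :=
  Matrix.of fun l k => s (l.1 + k.1 + r) l.2 k.2

/-- `H_{1,j}`. -/
def H1 (s : ℕ → Mat q) (j : ℕ) : BlockMat q j := hankel s 0 j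

/-- `H_{2,j}`. -/
def H2 (a b : ℝ) (s : ℕ → Mat q) (j : ℕ) : BlockMat q j :=
  -((a : ℂ) * b) • hankel s 0 j + ((a : ℂ) + b) • hankel s 1 j - hankel s 2 j

/-- `K_{1,j}`. -/
def K1 (b : ℝ) (s : ℕ → Mat q) (j : ℕ) : BlockMat q j :=
  (b : ℂ) • hankel s 0 j - hankel s 1 j

/-- `K_{2,j}`. -/
def K2 (a : ℝ) (s : ℕ → Mat q) (j : ℕ) : BlockMat q j :=
  -(a : ℂ) • hankel s 0 j + hankel s 1 j

/-- `(s_k)_{k=0}^{2n}` is a Hausdorff positive definite sequence on `[a,b]`: `H_{1,n}` and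
`H_{2,n-1}` are positive definite (for `n = 0` the second condition is void). -/
def HausdorffPosDefEven (a b : ℝ) (s : ℕ → Mat q) (n : ℕ) : Prop :=
  (H1 s n).PosDef ∧ ∀ k, k + 1 = n → (H2 a b s k).PosDef

/-- `(s_k)_{k=0}^{2n+1}` is a Hausdorff positive definite sequence on `[a,b]`: `K_{1,n}` and
`K_{2,n}` are positive definite. -/
def HausdorffPosDefOdd (a b : ℝ) (s : ℕ → Mat q) (n : ℕ) : Prop :=
  (K1 b s n).PosDef ∧ (K2 a s n).PosDef

/-- The block shift `T_j`, with identity blocks on the first block subdiagonal. -/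
def T (q j : ℕ) : BlockMat q j :=
  Matrix.of fun i k => if (i.1 : ℕ) = k.1 + 1 ∧ i.2 = k.2 then 1 else 0

/-- `R_j(z) = (I - z T_j)⁻¹`. -/
def R (q j : ℕ) (z : ℂ) : BlockMat q j := (1 - z • T q j)⁻¹

/-- `v_j`, the block column `(I, 0, …, 0)`. -/
def v (q j : ℕ) : BlockCol q j := blockCol (fun i => if i = 0 then 1 else 0) j

/-- `ŝ_j`. -/
def sHat (a b : ℝ) (s : ℕ → Mat q) (j : ℕ) : Mat q :=
  -((a : ℂ) * b) • s j + ((a : ℂ) + b) • s (j + 1) - s (j + 2)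

/-- `u_{1,j}`, the block column `(0, -s_0, …, -s_{j-1})`. -/
def u1 (s : ℕ → Mat q) (j : ℕ) : BlockCol q j :=
  blockCol (fun i => match i with
    | 0 => 0
    | i + 1 => -s i) j

/-- `u_{2,j}`, the block column `(-(a+b)s_0 + s_1, -ŝ_0, …, -ŝ_{j-1})`. -/
def u2 (a b : ℝ) (s : ℕ → Mat q) (j : ℕ) : BlockCol q j :=
  blockCol (fun i => match i with
    | 0 => -((a : ℂ) + b) • s 0 + s 1
    | i + 1 => -sHat a b s i) j

/-- `ũ_{1,j}`, the block column `(s_0, s_1 - b s_0, …, s_j - b s_{j-1})`. -/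
def uTilde1 (b : ℝ) (s : ℕ → Mat q) (j : ℕ) : BlockCol q j :=
  blockCol (fun i => match i with
    | 0 => s 0
    | i + 1 => s (i + 1) - (b : ℂ) • s i) j

/-- `ũ_{2,j}`, the block column `(-s_0, -s_1 + a s_0, …, -s_j + a s_{j-1})`. -/
def uTilde2 (a : ℝ) (s : ℕ → Mat q) (j : ℕ) : BlockCol q j :=
  blockCol (fun i => match i with
    | 0 => -s 0
    | i + 1 => -s (i + 1) + (a : ℂ) • s i) j

/-- `Y_{1,j+1}`, the block column `(s_{j+1}, …, s_{2j+1})`. -/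
def Y1 (s : ℕ → Mat q) (j : ℕ) : BlockCol q j :=
  blockCol (fun i => s (j + 1 + i)) j

/-- `Y_{2,j+1}`, the block column `(ŝ_{j+1}, …, ŝ_{2j+1})`. -/
def Y2 (a b : ℝ) (s : ℕ → Mat q) (j : ℕ) : BlockCol q j :=
  blockCol (fun i => sHat a b s (j + 1 + i)) j

/-- `Ỹ_{1,j+1}`, the block column with blocks `b s_{j+1+i} - s_{j+2+i}`, `0 ≤ i ≤ j`. -/
def YTilde1 (b : ℝ) (s : ℕ → Mat q) (j : ℕ) : BlockCol q j :=
  blockCol (fun i => (b : ℂ) • s (j + 1 + i) - s (j + 2 + i)) j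

/-- `Ỹ_{2,j+1}`, the block column with blocks `-a s_{j+1+i} + s_{j+2+i}`, `0 ≤ i ≤ j`. -/
def YTilde2 (a : ℝ) (s : ℕ → Mat q) (j : ℕ) : BlockCol q j :=
  blockCol (fun i => -(a : ℂ) • s (j + 1 + i) + s (j + 2 + i)) j

/-- The block row `(A, I_q)`. -/
def appendId {j : ℕ} (A : BlockRow q j) : BlockRow q (j + 1) :=
  Matrix.of fun i p =>
    Fin.lastCases (motive := fun _ => ℂ) ((1 : Mat q) i p.2) (fun r => A i (r, p.2)) p.1

/-- `P_{1,j}`. -/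
def P1 (s : ℕ → Mat q) : ℕ → ℂ → Mat q
  | 0, _ => 1
  | j + 1, z => appendId (-((Y1 s j)ᴴ * (H1 s j)⁻¹)) * R q (j + 1) z * v q (j + 1)

/-- `Q_{1,j}`. -/
def Q1 (s : ℕ → Mat q) : ℕ → ℂ → Mat q
  | 0, _ => 0
  | j + 1, z => -(appendId (-((Y1 s j)ᴴ * (H1 s j)⁻¹)) * R q (j + 1) z * u1 s (j + 1))

/-- `P_{2,j}`. -/
def P2 (a b : ℝ) (s : ℕ → Mat q) : ℕ → ℂ → Mat q
  | 0, _ => 1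
  | j + 1, z => appendId (-((Y2 a b s j)ᴴ * (H2 a b s j)⁻¹)) * R q (j + 1) z * v q (j + 1)

/-- `Q_{2,j}`. -/
def Q2 (a b : ℝ) (s : ℕ → Mat q) : ℕ → ℂ → Mat q
  | 0, z => -((-((a : ℂ) + b) • s 0 + s 1) + z • s 0)
  | j + 1, z => -(appendId (-((Y2 a b s j)ᴴ * (H2 a b s j)⁻¹)) * R q (j + 1) z *
      (u2 a b s (j + 1) + z • (v q (j + 1) * s 0)))

/-- `Γ_{1,j}`. -/
def Gamma1 (b : ℝ) (s : ℕ → Mat q) : ℕ → ℂ → Mat q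
  | 0, _ => 1
  | j + 1, z => appendId (-((YTilde1 b s j)ᴴ * (K1 b s j)⁻¹)) * R q (j + 1) z * v q (j + 1)

/-- `Γ_{2,j}`. -/
def Gamma2 (a : ℝ) (s : ℕ → Mat q) : ℕ → ℂ → Mat q
  | 0, _ => 1
  | j + 1, z => appendId (-((YTilde2 a s j)ᴴ * (K2 a s j)⁻¹)) * R q (j + 1) z * v q (j + 1)

/-- `Θ_{1,j}`. -/
def Theta1 (b : ℝ) (s : ℕ → Mat q) : ℕ → ℂ → Mat q
  | 0, _ => s 0
  | j + 1, z =>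
      appendId (-((YTilde1 b s j)ᴴ * (K1 b s j)⁻¹)) * R q (j + 1) z * uTilde1 b s (j + 1)

/-- `Θ_{2,j}`. -/
def Theta2 (a : ℝ) (s : ℕ → Mat q) : ℕ → ℂ → Mat q
  | 0, _ => -s 0
  | j + 1, z =>
      appendId (-((YTilde2 a s j)ᴴ * (K2 a s j)⁻¹)) * R q (j + 1) z * uTilde2 a s (j + 1)

/-- `(u*_{2,j} + a s_0 v_j*) R_j*(a) H_{2,j}⁻¹ R_j(a) (u_{2,j} + a v_j s_0)`. -/
def lSum (a b : ℝ) (s : ℕ → Mat q) (j : ℕ) : Mat q :=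
  ((u2 a b s j)ᴴ + (a : ℂ) • (s 0 * (v q j)ᴴ)) * (R q j a)ᴴ * (H2 a b s j)⁻¹ * R q j a *
    (u2 a b s j + (a : ℂ) • (v q j * s 0))

/-- The parameters `𝐥_j`, `j ≥ 0`. -/
def l (a b : ℝ) (s : ℕ → Mat q) : ℕ → Mat q
  | 0 => lSum a b s 0
  | j + 1 => lSum a b s (j + 1) - lSum a b s j

/-- `v_j* R_j*(a) K_{1,j}⁻¹ R_j(a) v_j`. -/
def mSum (a b : ℝ) (s : ℕ → Mat q) (j : ℕ) : Mat q :=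
  (v q j)ᴴ * (R q j a)ᴴ * (K1 b s j)⁻¹ * R q j a * v q j

/-- The parameters `𝐦_j`, `j ≥ 0`. -/
def m (a b : ℝ) (s : ℕ → Mat q) : ℕ → Mat q
  | 0 => mSum a b s 0
  | j + 1 => mSum a b s (j + 1) - mSum a b s j

/-- `v_j* R_j*(a) H_{1,j}⁻¹ R_j(a) v_j`. -/
def MSum (a : ℝ) (s : ℕ → Mat q) (j : ℕ) : Mat q :=
  (v q j)ᴴ * (R q j a)ᴴ * (H1 s j)⁻¹ * R q j a * v q j

/-- The parameters `𝐌_j`, `j ≥ 0`. -/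
def M (a : ℝ) (s : ℕ → Mat q) : ℕ → Mat q
  | 0 => (s 0)⁻¹
  | j + 1 => MSum a s (j + 1) - MSum a s j

/-- `ũ*_{2,j} R_j*(a) K_{2,j}⁻¹ R_j(a) ũ_{2,j}`. -/
def LSum (a : ℝ) (s : ℕ → Mat q) (j : ℕ) : Mat q :=
  (uTilde2 a s j)ᴴ * (R q j a)ᴴ * (K2 a s j)⁻¹ * R q j a * uTilde2 a s j

/-- The parameters `𝐋_j`, `j ≥ 0`. -/
def L (a : ℝ) (s : ℕ → Mat q) : ℕ → Mat q
  | 0 => LSum a s 0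
  | j + 1 => LSum a s (j + 1) - LSum a s j

/-- The denominator `(b - z) Γ*_{1,n}(z̄)` of the even Friedrichs extremal solution. -/
def denFriedrichsEven (b : ℝ) (s : ℕ → Mat q) (n : ℕ) (z : ℂ) : Mat q :=
  ((b : ℂ) - z) • (Gamma1 b s n (star z))ᴴ

/-- The even Friedrichs extremal solution `Θ*_{1,n}(z̄) / ((b - z) Γ*_{1,n}(z̄))`. -/
def friedrichsEven (b : ℝ) (s : ℕ → Mat q) (n : ℕ) (z : ℂ) : Mat q :=
  (Theta1 b s n (star z))ᴴ * (denFriedrichsEven b s n z)⁻¹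

/-- The denominator `(z - a) Γ*_{2,n}(z̄)` of the even Krein extremal solution. -/
def denKreinEven (a : ℝ) (s : ℕ → Mat q) (n : ℕ) (z : ℂ) : Mat q :=
  (z - (a : ℂ)) • (Gamma2 a s n (star z))ᴴ

/-- The even Krein extremal solution `Θ*_{2,n}(z̄) / ((z - a) Γ*_{2,n}(z̄))`. -/
def kreinEven (a : ℝ) (s : ℕ → Mat q) (n : ℕ) (z : ℂ) : Mat q :=
  (Theta2 a s n (star z))ᴴ * (denKreinEven a s n z)⁻¹

/-- The denominator `P*_{1,n+1}(z̄)` of the odd Friedrichs extremal solution. -/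
def denFriedrichsOdd (s : ℕ → Mat q) (n : ℕ) (z : ℂ) : Mat q :=
  (P1 s (n + 1) (star z))ᴴ

/-- The odd Friedrichs extremal solution `-Q*_{1,n+1}(z̄) / P*_{1,n+1}(z̄)`. -/
def friedrichsOdd (s : ℕ → Mat q) (n : ℕ) (z : ℂ) : Mat q :=
  -((Q1 s (n + 1) (star z))ᴴ * (denFriedrichsOdd s n z)⁻¹)

/-- The denominator `(z - a)(b - z) P*_{2,n}(z̄)` of the odd Krein extremal solution. -/
def denKreinOdd (a b : ℝ) (s : ℕ → Mat q) (n : ℕ) (z : ℂ) : Mat q :=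
  ((z - (a : ℂ)) * ((b : ℂ) - z)) • (P2 a b s n (star z))ᴴ

/-- The odd Krein extremal solution `-Q*_{2,n}(z̄) / ((z - a)(b - z) P*_{2,n}(z̄))`. -/
def kreinOdd (a b : ℝ) (s : ℕ → Mat q) (n : ℕ) (z : ℂ) : Mat q :=
  -((Q2 a b s n (star z))ᴴ * (denKreinOdd a b s n z)⁻¹)

/-- The finite matrix continued fraction `c₀ + I/(c₁ + I/(c₂ + ⋯ + I/c_k))` of the nonempty
list `[c₀, …, c_k]`. -/
def contFrac : List (Mat q) → Mat q
  | [] => 0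
  | [c] => c
  | c :: d :: t => c + (contFrac (d :: t))⁻¹

/-- Every denominator that occurs in the continued fraction of the list is invertible. -/
def ContFracDefined : List (Mat q) → Prop
  | [] => True
  | [_] => True
  | _ :: d :: t => IsUnit (contFrac (d :: t)) ∧ ContFracDefined (d :: t)

/-- `-(z-a)(b-z)𝐦_0, (b-z)⁻¹𝐥_0, …, -(z-a)(b-z)𝐦_{n-1}, (b-z)⁻¹𝐥_{n-1}`. -/
def mlList (a b : ℝ) (s : ℕ → Mat q) (z : ℂ) (n : ℕ) : List (Mat q) :=
  (List.range n).flatMap fun j =>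
    [-((z - (a : ℂ)) * ((b : ℂ) - z)) • m a b s j, ((b : ℂ) - z)⁻¹ • l a b s j]

/-- `-(z-a)𝐌_0, 𝐋_0, …, -(z-a)𝐌_{n-1}, 𝐋_{n-1}`. -/
def MLList (a : ℝ) (s : ℕ → Mat q) (z : ℂ) (n : ℕ) : List (Mat q) :=
  (List.range n).flatMap fun j => [-(z - (a : ℂ)) • M a s j, L a s j]

/-- The terms of the continued fraction of the even Friedrichs extremal solution. -/
def termsFriedrichsEven (a b : ℝ) (s : ℕ → Mat q) (n : ℕ) (z : ℂ) : List (Mat q) :=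
  ((b : ℂ) - z)⁻¹ • s 0 :: mlList a b s z n

/-- The terms of the continued fraction of the even Krein extremal solution. -/
def termsKreinEven (a : ℝ) (s : ℕ → Mat q) (n : ℕ) (z : ℂ) : List (Mat q) :=
  0 :: (MLList a s z n ++ [-(z - (a : ℂ)) • M a s n])

/-- The terms of the continued fraction of the odd Friedrichs extremal solution. -/
def termsFriedrichsOdd (a : ℝ) (s : ℕ → Mat q) (n : ℕ) (z : ℂ) : List (Mat q) :=
  0 :: (MLList a s z n ++ [-(z - (a : ℂ)) • M a s n, L a s n])

/-- The terms of the continued fraction of the odd Krein extremal solution. -/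
def termsKreinOdd (a b : ℝ) (s : ℕ → Mat q) (n : ℕ) (z : ℂ) : List (Mat q) :=
  ((b : ℂ) - z)⁻¹ • s 0 ::
    (mlList a b s z n ++ [-((z - (a : ℂ)) * ((b : ℂ) - z)) • m a b s n])

end THMM

end

/-!
Reading block rows as matrix polynomials turns `P_{1,j}` and `Γ_{2,j}` into the monic orthogonal
polynomials of the representing measure `σ` and of `(t - a) σ`, their partners `Q_{1,j}` and
`Θ_{2,j}` into functions of the second kind, and the sums of the DSM parameters into
`∑_{i ≤ j} 𝐌_i = k_{j+1}(a)` and `∑_{i ≤ j} 𝐋_i = ∫ d_{j+1} σ`. Here `k_j` reproduces the value at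
`a` on the polynomials of degree less than `j`, and `d_j` represents `p ↦ ∫ p σ` with respect to
`(t - a) σ`. The polynomial `p_j = 1 - (t - a) d_j` is orthogonal with value `I` at `a`, and
`k_{j+1} = k_j + 𝐌_j p_j`, `p_{j+1} = p_j - 𝐋_j (t - a) k_{j+1}`. Hence the remainders of
`p_0, -(t - a) k_1, p_1, -(t - a) k_2, …` in approximating the extremal solution obey a three-term
recurrence with coefficients `-(z - a) 𝐌_j` and `𝐋_j`. The last remainder vanishes, and unrolling
the recurrence gives the continued fraction.

The polynomials `p_j` and `√(t - a) k_{j+1}` form one orthogonal sequence in the variable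
`√(t - a)`. All denominators are invertible because a square root of `z - a` would otherwise lie in
the numerical range of multiplication by `√(t - a)`, which is real with squares in `[0, b - a]`.

The two fractions in `𝐥_j` and `𝐦_j` come from those in `𝐋_j` and `𝐌_j` for `(b - t) σ` by an
equivalence transformation of continued fractions with the factor `b - z`.
-/

open Polynomial

noncomputable section

namespace THMM

section Pairing

variable {𝕜 A : Type*} [CommRing 𝕜] [Ring A] [Algebra 𝕜 A]

/-- The left linear functional `∑ pᵢ tⁱ ↦ ∑ pᵢ cᵢ` on polynomials with noncommuting coefficients,
written on the left of the central variable `t`. -/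
def pairing (c : ℕ → A) : A[X] →ₗ[A] A :=
  Polynomial.lsum fun i => LinearMap.toSpanSingleton A A (c i)

theorem pairing_eq_sum (c : ℕ → A) {n : ℕ} {p : A[X]} (hp : p ∈ A[X]_n) :
    pairing c p = ∑ i ∈ Finset.range n, p.coeff i * c i := by
  rw [mem_degreeLT] at hp
  rw [pairing, lsum_apply, sum_def]
  refine Finset.sum_subset (fun i hi => ?_) fun i _ hi => ?_
  · exact Finset.mem_range.2 (WithBot.coe_lt_coe.1 ((le_degree_of_mem_supp i hi).trans_lt hp))
  · rw [notMem_support_iff.1 hi, map_zero]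

theorem exists_mem_degreeLT (p : A[X]) : ∃ n, p ∈ A[X]_n :=
  ⟨p.natDegree + 1, mem_degreeLT.2 (degree_lt_iff_coeff_zero _ _ |>.2 fun _ hi =>
    coeff_eq_zero_of_natDegree_lt hi)⟩

theorem coeff_eq_zero_of_mem_degreeLT {n i : ℕ} {p : A[X]} (hp : p ∈ A[X]_n) (hi : n ≤ i) :
    p.coeff i = 0 :=
  (degree_lt_iff_coeff_zero p n).1 (mem_degreeLT.1 hp) i hi

theorem pairing_congr {c d : ℕ → A} {n : ℕ} {p : A[X]} (hp : p ∈ A[X]_n)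
    (h : ∀ i < n, c i = d i) : pairing c p = pairing d p := by
  rw [pairing_eq_sum c hp, pairing_eq_sum d hp]
  exact Finset.sum_congr rfl fun i hi => by rw [h i (Finset.mem_range.1 hi)]

theorem pairing_monomial (c : ℕ → A) (i : ℕ) (B : A) : pairing c (monomial i B) = B * c i := by
  simp [pairing]

theorem pairing_one (c : ℕ → A) : pairing c 1 = c 0 := by
  rw [← monomial_zero_one, pairing_monomial, one_mul]

theorem pairing_sub_seq (c d : ℕ → A) (p : A[X]) :
    pairing (fun i => c i - d i) p = pairing c p - pairing d p := by
  obtain ⟨n, hn⟩ := exists_mem_degreeLT p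
  simp only [pairing_eq_sum _ hn, mul_sub, Finset.sum_sub_distrib]

theorem pairing_smul_seq (z : 𝕜) (c : ℕ → A) (p : A[X]) :
    pairing (fun i => z • c i) p = z • pairing c p := by
  obtain ⟨n, hn⟩ := exists_mem_degreeLT p
  simp only [pairing_eq_sum _ hn, mul_smul_comm, Finset.smul_sum]

theorem pairing_mul_X (c : ℕ → A) (p : A[X]) :
    pairing c (p * X) = pairing (fun i => c (i + 1)) p := by
  induction p using Polynomial.induction_on' with
  | add p r hp hr => rw [add_mul, map_add, map_add, hp, hr]
  | monomial i B => rw [monomial_mul_X, pairing_monomial, pairing_monomial]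

theorem map_central_smul (φ : A[X] →ₗ[A] A) (z : 𝕜) (p : A[X]) : φ (z • p) = z • φ p := by
  rw [← one_smul A p, ← smul_assoc, map_smul, map_smul, smul_assoc]

/-- Evaluation of a polynomial at the central element `z`, as a left linear map. -/
def evalScalar (z : 𝕜) : A[X] →ₗ[A] A := leval (algebraMap 𝕜 A z)

theorem evalScalar_one (z : 𝕜) : evalScalar z (1 : A[X]) = 1 := eval_one

theorem pairing_powers (z : 𝕜) (p : A[X]) :
    pairing (fun i => z ^ i • (1 : A)) p = evalScalar z p := by
  induction p using Polynomial.induction_on' with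
  | add p r hp hr => rw [map_add, map_add, hp, hr]
  | monomial i B =>
    simp [pairing_monomial, evalScalar, leval_apply, ← map_pow, Algebra.smul_def]

/-- Multiplication of polynomials by `t - z`, for `z` a scalar. -/
def mulXSub (z : 𝕜) : A[X] →ₗ[A] A[X] := LinearMap.mulRight A (X - C (algebraMap 𝕜 A z))

theorem mulXSub_eq (z : 𝕜) (p : A[X]) : mulXSub z p = p * X - z • p := by
  rw [mulXSub, LinearMap.mulRight_apply, mul_sub, ← Polynomial.algebraMap_apply,
    ← Algebra.commutes, Algebra.smul_def]

theorem mulXSub_injective (z : 𝕜) : Function.Injective (mulXSub z : A[X] →ₗ[A] A[X]) :=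
  (monic_X_sub_C _).isRegular.right

theorem mulXSub_eq_add (z w : 𝕜) (p : A[X]) : mulXSub z p = mulXSub w p + (w - z) • p := by
  simp only [mulXSub_eq, sub_smul]
  abel

theorem mulXSub_mem_degreeLT_iff (z : 𝕜) {n : ℕ} {p : A[X]} :
    mulXSub z p ∈ A[X]_(n + 1) ↔ p ∈ A[X]_n := by
  nontriviality A
  rw [mem_degreeLT, mem_degreeLT, mulXSub, LinearMap.mulRight_apply, (monic_X_sub_C _).degree_mul,
    degree_X_sub_C, Nat.cast_succ, WithBot.add_lt_add_iff_right WithBot.one_ne_bot]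

theorem pairing_mulXSub (c : ℕ → A) (z : 𝕜) (p : A[X]) :
    pairing c (mulXSub z p) = pairing (fun i => c (i + 1)) p - z • pairing c p := by
  rw [mulXSub_eq, map_sub, pairing_mul_X, map_central_smul]

theorem evalScalar_mulXSub (w z : 𝕜) (p : A[X]) :
    evalScalar w (mulXSub z p) = (w - z) • evalScalar w p := by
  rw [← pairing_powers, pairing_mulXSub]
  simp only [pow_succ', mul_smul, pairing_smul_seq, pairing_powers, sub_smul]

theorem evalScalar_mulXSub_self (z : 𝕜) (p : A[X]) : evalScalar z (mulXSub z p) = 0 := by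
  rw [evalScalar_mulXSub, sub_self, zero_smul]

theorem one_mem_degreeLT (n : ℕ) : (1 : A[X]) ∈ A[X]_(n + 1) := by
  rw [mem_degreeLT]
  exact degree_one_le.trans_lt (by exact_mod_cast n.succ_pos)

theorem exists_eq_mulXSub {z : 𝕜} {n : ℕ} {p : A[X]} (hp : p ∈ A[X]_(n + 1))
    (hz : evalScalar z p = 0) : ∃ e ∈ A[X]_n, p = mulXSub z e := by
  nontriviality A
  set c := algebraMap 𝕜 A z with hc
  have hdiv : p = p %ₘ (X - C c) + mulXSub z (p /ₘ (X - C c)) := by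
    have hcomm : Commute (p /ₘ (X - C c)) (X - C c) :=
      (commute_X _).symm.sub_right (Algebra.commutes z _).symm
    rw [mulXSub, LinearMap.mulRight_apply, hcomm.eq, modByMonic_add_div]
  have hmod : p %ₘ (X - C c) = 0 := by
    have hdeg : (p %ₘ (X - C c)).degree < 1 := by
      simpa only [degree_X_sub_C] using degree_modByMonic_lt p (monic_X_sub_C c)
    obtain ⟨r, hr⟩ : ∃ r, p %ₘ (X - C c) = C r :=
      ⟨_, eq_C_of_degree_le_zero (Nat.WithBot.lt_one_iff_le_zero.1 hdeg)⟩
    rw [hdiv, map_add, evalScalar_mulXSub_self, add_zero, hr, evalScalar, leval_apply,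
      eval_C] at hz
    rw [hr, hz, C_0]
  rw [hmod, zero_add] at hdiv
  exact ⟨_, (mulXSub_mem_degreeLT_iff z).1 (hdiv ▸ hp), hdiv⟩

end Pairing

variable {q : ℕ}

section Moments

/-- The moments of `(t - a) σ`, if `s` is the sequence of moments of `σ`. -/
def leftWeighted (a : ℝ) (s : ℕ → Mat q) (k : ℕ) : Mat q := s (k + 1) - (a : ℂ) • s k

/-- The moments of `(b - t) σ`, if `s` is the sequence of moments of `σ`. -/
def rightWeighted (b : ℝ) (s : ℕ → Mat q) (k : ℕ) : Mat q := (b : ℂ) • s k - s (k + 1)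

theorem leftWeighted_rightWeighted (a b : ℝ) (s : ℕ → Mat q) :
    leftWeighted a (rightWeighted b s) = rightWeighted b (leftWeighted a s) := by
  funext k
  simp only [leftWeighted, rightWeighted, smul_sub, smul_comm (a : ℂ)]
  abel

/-- The moment `∫ p(t) σ(dt) tᵏ` of a polynomial `p`, if `s` is the sequence of moments of `σ`. -/
def moment (s : ℕ → Mat q) (k : ℕ) : (Mat q)[X] →ₗ[Mat q] Mat q := pairing fun i => s (i + k)

theorem moment_one (s : ℕ → Mat q) (k : ℕ) : moment s k 1 = s k := by
  rw [moment, pairing_one, Nat.zero_add]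

theorem moment_mulXSub (s : ℕ → Mat q) (k : ℕ) (z : ℂ) (p : (Mat q)[X]) :
    moment s k (mulXSub z p) = moment s (k + 1) p - z • moment s k p := by
  simp only [moment, pairing_mulXSub, Nat.add_right_comm _ 1 k, Nat.add_assoc]

theorem moment_leftWeighted (a : ℝ) (s : ℕ → Mat q) (k : ℕ) (p : (Mat q)[X]) :
    moment (leftWeighted a s) k p = moment s k (mulXSub (a : ℂ) p) := by
  rw [moment_mulXSub]
  simp only [moment, leftWeighted, pairing_sub_seq, pairing_smul_seq, Nat.add_assoc]

theorem moment_rightWeighted (b : ℝ) (s : ℕ → Mat q) (k : ℕ) (p : (Mat q)[X]) :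
    moment (rightWeighted b s) k p = -moment s k (mulXSub (b : ℂ) p) := by
  rw [moment_mulXSub, neg_sub]
  simp only [moment, rightWeighted, pairing_sub_seq, pairing_smul_seq, Nat.add_assoc]

theorem moment_eq_zero_of_mulXSub {s : ℕ → Mat q} {w : ℂ} {e : (Mat q)[X]} {j : ℕ}
    (h0 : moment s 0 e = 0) (h : ∀ k < j, moment s k (mulXSub w e) = 0) :
    ∀ k ≤ j, moment s k e = 0 := by
  intro k
  induction k with
  | zero => exact fun _ => h0
  | succ k ih =>
    intro hk
    have := h k hk
    rwa [moment_mulXSub, ih (by omega), smul_zero, sub_zero] at this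

/-- The sequence `x₀ = W`, `xᵢ₊₁ = z xᵢ + cᵢ`: the blocks of the solution of
`(I - z T) x = (W, c₀, c₁, …)`. -/
def resolventSeq (z : ℂ) (W : Mat q) (c : ℕ → Mat q) : ℕ → Mat q
  | 0 => W
  | i + 1 => z • resolventSeq z W c i + c i

theorem resolventSeq_eq_add (z : ℂ) (W : Mat q) (c : ℕ → Mat q) (i : ℕ) :
    resolventSeq z W c i = z ^ i • W + resolventSeq z 0 c i := by
  induction i with
  | zero => simp [resolventSeq]
  | succ i ih =>
    rw [resolventSeq, ih, resolventSeq, smul_add, smul_smul, ← pow_succ', add_assoc]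

theorem resolventSeq_neg (z : ℂ) (W : Mat q) (c : ℕ → Mat q) (i : ℕ) :
    resolventSeq z (-W) (fun i => -c i) i = -resolventSeq z W c i := by
  induction i with
  | zero => rfl
  | succ i ih => rw [resolventSeq, ih, resolventSeq, smul_neg, neg_add]

theorem resolventSeq_leftWeighted (a : ℝ) (s : ℕ → Mat q) (w : ℂ) (W : Mat q) (i : ℕ) :
    resolventSeq w ((w - a) • W + s 0) (leftWeighted a s) i =
      resolventSeq w W s (i + 1) - (a : ℂ) • resolventSeq w W s i := by
  induction i with
  | zero => simp only [resolventSeq, sub_smul]; abel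
  | succ i ih =>
    rw [resolventSeq, ih]
    simp only [resolventSeq, leftWeighted, smul_add, smul_sub, smul_comm (a : ℂ)]
    abel

/-- If `s` and `W` are the moments and the value at `w` of the transform `∫ σ(dt) (t - w)⁻¹`, then
`remainder s w W B` is the function of the second kind `∫ B(t) σ(dt) (t - w)⁻¹`. -/
def remainder (s : ℕ → Mat q) (w : ℂ) (W : Mat q) : (Mat q)[X] →ₗ[Mat q] Mat q :=
  pairing (resolventSeq w W s)

section

variable (s : ℕ → Mat q) (w : ℂ) (W : Mat q)

theorem remainder_one : remainder s w W 1 = W := pairing_one _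

theorem remainder_mulXSub (z : ℂ) (B : (Mat q)[X]) :
    remainder s w W (mulXSub z B) = (w - z) • remainder s w W B + moment s 0 B := by
  have hshift : pairing (fun i => resolventSeq w W s (i + 1)) B =
      w • remainder s w W B + moment s 0 B := by
    have hs : moment s 0 B =
        pairing (fun i => resolventSeq w W s (i + 1) - w • resolventSeq w W s i) B :=
      congrArg (pairing · B) (funext fun i => (add_sub_cancel_left _ _).symm)
    rw [hs, pairing_sub_seq, pairing_smul_seq, remainder, add_sub_cancel]
  rw [remainder, pairing_mulXSub, hshift, sub_smul, remainder]
  abel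

theorem remainder_eq_add (B : (Mat q)[X]) :
    remainder s w W B = evalScalar w B * W + remainder s w 0 B := by
  induction B using Polynomial.induction_on' with
  | add B D hB hD => simp only [map_add, hB, hD, add_mul]; abel
  | monomial i B =>
    rw [← pairing_powers, remainder, remainder]
    simp only [pairing_monomial, resolventSeq_eq_add w W s i, mul_add, mul_smul_comm,
      smul_mul_assoc, mul_one]

theorem remainder_leftWeighted (a : ℝ) (B : (Mat q)[X]) :
    remainder (leftWeighted a s) w ((w - a) • W + s 0) B = remainder s w W (mulXSub (a : ℂ) B) := by
  rw [remainder, remainder, pairing_mulXSub, ← pairing_smul_seq, ← pairing_sub_seq]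
  exact congrArg (pairing · B) (funext (resolventSeq_leftWeighted a s w W))

end

end Moments

section Form

/-- The matrix inner product `∫ p(t) σ(dt) r(t)*` of the polynomials `p` and `r`, that is
`∑ pᵢ sᵢ₊ₖ rₖ*`, if `s` is the sequence of moments of `σ`. -/
def form (s : ℕ → Mat q) (p r : (Mat q)[X]) : Mat q := (pairing (fun k => (moment s k p)ᴴ) r)ᴴ

variable {s : ℕ → Mat q} {a b : ℝ} {p p' r r' : (Mat q)[X]} {m n N : ℕ}

theorem form_eq_sum (s : ℕ → Mat q) (p : (Mat q)[X]) (hr : r ∈ (Mat q)[X]_n) :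
    form s p r = ∑ k ∈ Finset.range n, moment s k p * (r.coeff k)ᴴ := by
  rw [form, pairing_eq_sum _ hr, Matrix.conjTranspose_sum]
  simp only [Matrix.conjTranspose_mul, Matrix.conjTranspose_conjTranspose]

theorem form_eq_pairing (s : ℕ → Mat q) (p r : (Mat q)[X]) :
    form s p r = pairing (fun i => (pairing (fun k => (s (i + k))ᴴ) r)ᴴ) p := by
  obtain ⟨m, hm⟩ := exists_mem_degreeLT p
  obtain ⟨n, hn⟩ := exists_mem_degreeLT r
  simp only [form_eq_sum s p hn, moment, pairing_eq_sum _ hm, pairing_eq_sum _ hn,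
    Matrix.conjTranspose_sum, Matrix.conjTranspose_mul, Matrix.conjTranspose_conjTranspose,
    Finset.sum_mul, Finset.mul_sum, mul_assoc]
  exact Finset.sum_comm

theorem form_add_left : form s (p + p') r = form s p r + form s p' r := by
  simp only [form_eq_pairing, map_add]

theorem form_sub_left : form s (p - p') r = form s p r - form s p' r := by
  simp only [form_eq_pairing, map_sub]

theorem form_smul_left (Y : Mat q) : form s (Y • p) r = Y * form s p r := by
  simp only [form_eq_pairing, map_smul, smul_eq_mul]

theorem form_central_smul_left (z : ℂ) : form s (z • p) r = z • form s p r := by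
  simp only [form_eq_pairing, map_central_smul]

theorem form_zero_left : form s 0 r = 0 := by
  simp only [form_eq_pairing, map_zero]

theorem form_add_right : form s p (r + r') = form s p r + form s p r' := by
  simp only [form, map_add, Matrix.conjTranspose_add]

theorem form_central_smul_right (z : ℂ) : form s p (z • r) = star z • form s p r := by
  simp only [form, map_central_smul, Matrix.conjTranspose_smul]

theorem form_eq_zero (hr : r ∈ (Mat q)[X]_n) (h : ∀ k < n, moment s k p = 0) :
    form s p r = 0 := by
  rw [form_eq_sum s p hr]
  exact Finset.sum_eq_zero fun k hk => by rw [h k (Finset.mem_range.1 hk), zero_mul]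

theorem form_mulXSub_comm : form s (mulXSub (a : ℂ) p) r = form s p (mulXSub (a : ℂ) r) := by
  have hconj : ∀ k, (moment s k (mulXSub (a : ℂ) p))ᴴ =
      (moment s (k + 1) p)ᴴ - (a : ℂ) • (moment s k p)ᴴ := fun k => by
    rw [moment_mulXSub, Matrix.conjTranspose_sub, Matrix.conjTranspose_smul, Complex.star_def,
      Complex.conj_ofReal]
  simp only [form, hconj, pairing_sub_seq, pairing_smul_seq, pairing_mulXSub]

theorem form_leftWeighted : form (leftWeighted a s) p r = form s (mulXSub (a : ℂ) p) r := by
  simp only [form, moment_leftWeighted]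

theorem form_rightWeighted : form (rightWeighted b s) p r = -form s (mulXSub (b : ℂ) p) r := by
  have h : form (rightWeighted b s) p r = form s (-mulXSub (b : ℂ) p) r := by
    simp only [form, moment_rightWeighted, map_neg]
  rw [h, form_eq_pairing, form_eq_pairing, map_neg]

theorem form_leftWeighted_add_form_rightWeighted : form (leftWeighted a s) p r +
    form (rightWeighted b s) p r = ((b - a : ℝ) : ℂ) • form s p r := by
  rw [form_rightWeighted, mulXSub_eq_add (b : ℂ) (a : ℂ), form_add_left, form_central_smul_left,
    form_leftWeighted, Complex.ofReal_sub, ← neg_sub (b : ℂ), neg_smul]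
  abel

theorem form_leftWeighted_leftWeighted : form (leftWeighted a (leftWeighted a s)) p r =
    form s (mulXSub (a : ℂ) p) (mulXSub (a : ℂ) r) := by
  rw [form_leftWeighted, form_leftWeighted, form_mulXSub_comm]

/-- The matrices `s k`, `k < N`, are Hermitian. -/
def HermBelow (s : ℕ → Mat q) (N : ℕ) : Prop := ∀ k < N, (s k)ᴴ = s k

theorem HermBelow.mono (h : HermBelow s N) (hn : n ≤ N) : HermBelow s n :=
  fun k hk => h k (hk.trans_le hn)

theorem HermBelow.leftWeighted (h : HermBelow s (N + 1)) (a : ℝ) :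
    HermBelow (leftWeighted a s) N := fun k hk => by
  simp [THMM.leftWeighted, h k (by omega), h (k + 1) (by omega)]

theorem HermBelow.rightWeighted (h : HermBelow s (N + 1)) (b : ℝ) :
    HermBelow (rightWeighted b s) N := fun k hk => by
  simp [THMM.rightWeighted, h k (by omega), h (k + 1) (by omega)]

theorem HermBelow.conjTranspose_form (hs : HermBelow s N) (hp : p ∈ (Mat q)[X]_m)
    (hr : r ∈ (Mat q)[X]_n) (h : m + n ≤ N + 1) : (form s p r)ᴴ = form s r p := by
  rw [form, Matrix.conjTranspose_conjTranspose, form_eq_pairing]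
  refine pairing_congr hr fun k hk => congrArg _ (pairing_congr hp fun i hi => ?_)
  rw [hs (k + i) (by omega), Nat.add_comm]

/-- The form of `s` is positive definite on the polynomials of degree less than `n`. The trace of
the matrix value suffices, since the form is left linear over the matrices. -/
def PosDefBelow (s : ℕ → Mat q) (n : ℕ) : Prop :=
  ∀ p ∈ (Mat q)[X]_n, p ≠ 0 → 0 < (form s p p).trace

/-- The form of `s` is positive semidefinite on the polynomials of degree less than `n`. -/
def PosSemidefBelow (s : ℕ → Mat q) (n : ℕ) : Prop :=
  ∀ p ∈ (Mat q)[X]_n, 0 ≤ (form s p p).trace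

theorem PosDefBelow.posSemidefBelow (h : PosDefBelow s n) : PosSemidefBelow s n := by
  intro p hp
  obtain rfl | h0 := eq_or_ne p 0
  · rw [form_zero_left, Matrix.trace_zero]
  · exact (h p hp h0).le

theorem PosDefBelow.mono (h : PosDefBelow s n) (hm : m ≤ n) : PosDefBelow s m :=
  fun p hp h0 => h p (degreeLT_mono hm hp) h0

theorem PosDefBelow.eq_zero (h : PosDefBelow s n) (hp : p ∈ (Mat q)[X]_n)
    (h0 : form s p p = 0) : p = 0 := by
  by_contra hne
  exact (h p hp hne).ne' (by rw [h0, Matrix.trace_zero])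

theorem PosDefBelow.eq_zero_of_moment (h : PosDefBelow s n) (hp : p ∈ (Mat q)[X]_n)
    (h0 : ∀ k < n, moment s k p = 0) : p = 0 :=
  h.eq_zero hp (form_eq_zero hp h0)

theorem PosDefBelow.leftWeighted_leftWeighted (hs : PosDefBelow s (n + 1)) (a : ℝ) :
    PosDefBelow (leftWeighted a (leftWeighted a s)) n := by
  intro p hp h0
  rw [form_leftWeighted_leftWeighted]
  exact hs _ ((mulXSub_mem_degreeLT_iff _).2 hp) ((map_ne_zero_iff _ (mulXSub_injective _)).2 h0)

/-- The sequence `s₀, s₁, …, s₂ₙ₋₂` is Hankel positive definite. -/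
structure IsPosDefSeq (s : ℕ → Mat q) (n : ℕ) : Prop where
  herm : HermBelow s (2 * n - 1)
  pos : PosDefBelow s n

theorem IsPosDefSeq.mono (h : IsPosDefSeq s n) (hm : m ≤ n) : IsPosDefSeq s m :=
  ⟨h.herm.mono (by omega), h.pos.mono hm⟩

end Form

section BlockMatrices

variable {s : ℕ → Mat q} {j : ℕ}

/-- The matrix polynomial whose coefficients are the blocks of a block row. -/
def rowPoly (A : BlockRow q j) : (Mat q)[X] :=
  ∑ k : Fin (j + 1), monomial k (A.submatrix id (Prod.mk k))

theorem rowPoly_mem_degreeLT (A : BlockRow q j) : rowPoly A ∈ (Mat q)[X]_(j + 1) :=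
  Submodule.sum_mem _ fun k _ => mem_degreeLT.2
    ((degree_monomial_le _ _).trans_lt (by exact_mod_cast k.2))

theorem exists_rowPoly_eq {p : (Mat q)[X]} (hp : p ∈ (Mat q)[X]_(j + 1)) :
    ∃ A : BlockRow q j, rowPoly A = p :=
  ⟨Matrix.of fun i k => p.coeff k.1 i k.2,
    (sum_fin _ (fun i => monomial_zero_right i) (mem_degreeLT.1 hp)).trans p.sum_monomial_eq⟩

theorem pairing_rowPoly (c : ℕ → Mat q) (A : BlockRow q j) :
    pairing c (rowPoly A) = A * blockCol c j := by
  ext i l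
  simp [rowPoly, pairing_monomial, Matrix.sum_apply, Matrix.mul_apply, Fintype.sum_prod_type,
    blockCol]

theorem rowPoly_eq_zero_iff {A : BlockRow q j} : rowPoly A = 0 ↔ A = 0 := by
  refine ⟨fun h => ?_, fun h => by simp [h, rowPoly, Matrix.submatrix_zero]⟩
  ext i ⟨k, l⟩
  have hk := pairing_rowPoly (Pi.single (k : ℕ) 1) A
  rw [h, map_zero] at hk
  have hcol : ∀ (x : Fin (j + 1)) y, blockCol (Pi.single (k : ℕ) (1 : Mat q)) j (x, y) l =
      if x = k then if y = l then 1 else 0 else 0 := fun x y => by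
    by_cases hx : x = k <;> simp [blockCol, Pi.single_apply, Fin.val_inj, hx, Matrix.one_apply]
  simpa [Matrix.mul_apply, Fintype.sum_prod_type, hcol] using (congrFun₂ hk i l).symm

theorem rowPoly_appendId_neg (A : BlockRow q j) :
    rowPoly (appendId (-A)) = monomial (j + 1) 1 - rowPoly A := by
  have hneg : rowPoly (-A) = -rowPoly A := by
    simp only [rowPoly, ← Finset.sum_neg_distrib, ← monomial_neg]
    rfl
  have happ : rowPoly (appendId (-A)) = rowPoly (-A) + monomial (j + 1) 1 := by
    rw [rowPoly, Fin.sum_univ_castSucc, rowPoly]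
    congr 1
    · refine Finset.sum_congr rfl fun k _ => congrArg _ ?_
      ext i l
      simp [appendId]
    · refine congrArg _ ?_
      ext i l
      simp [appendId]
  rw [happ, hneg, neg_add_eq_sub]

theorem mul_hankel (s : ℕ → Mat q) (A : BlockRow q j) :
    A * hankel s 0 j = (blockCol (fun k => (moment s k (rowPoly A))ᴴ) j)ᴴ := by
  ext i k
  simp [moment, pairing_rowPoly, Matrix.mul_apply, hankel, blockCol]

theorem form_rowPoly (s : ℕ → Mat q) (A B : BlockRow q j) :
    form s (rowPoly A) (rowPoly B) = A * hankel s 0 j * Bᴴ := by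
  rw [form, pairing_rowPoly, Matrix.conjTranspose_mul, mul_hankel]

theorem isHermitian_hankel_iff : (hankel s 0 j).IsHermitian ↔ HermBelow s (2 * j + 1) := by
  constructor
  · intro h k hk
    obtain ⟨i, hi, l, hl, rfl⟩ : ∃ i, i < j + 1 ∧ ∃ l, l < j + 1 ∧ k = l + i :=
      ⟨min k j, by omega, k - min k j, by omega, by omega⟩
    ext x y
    simpa [hankel, Nat.add_comm i l] using h.apply (⟨l, hl⟩, x) (⟨i, hi⟩, y)
  · intro h
    ext x y
    simpa [hankel, Nat.add_comm (y.1 : ℕ)] using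
      congrFun₂ (h (x.1 + y.1) (by omega)) x.2 y.2

theorem trace_mul_mul_conjTranspose {m n : Type*} [Fintype m] [Fintype n] (A : Matrix m n ℂ)
    (H : Matrix n n ℂ) : (A * H * Aᴴ).trace = ∑ i, star (star (A i)) ⬝ᵥ (H *ᵥ star (A i)) := by
  refine Finset.sum_congr rfl fun i _ => ?_
  rw [star_star, Matrix.dotProduct_mulVec]
  rfl

theorem posDef_hankel_iff : (hankel s 0 j).PosDef ↔ IsPosDefSeq s (j + 1) := by
  constructor
  · refine fun h => ⟨isHermitian_hankel_iff.1 h.1, fun p hp h0 => ?_⟩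
    obtain ⟨A, rfl⟩ := exists_rowPoly_eq hp
    obtain ⟨i, hi⟩ : ∃ i, A i ≠ 0 := Function.ne_iff.1 (rowPoly_eq_zero_iff.not.1 h0)
    rw [form_rowPoly, trace_mul_mul_conjTranspose]
    exact Finset.sum_pos' (fun i _ => h.posSemidef.dotProduct_mulVec_nonneg _)
      ⟨i, Finset.mem_univ i, h.dotProduct_mulVec_pos (star_ne_zero.2 hi)⟩
  · refine fun ⟨hh, hs⟩ => .of_dotProduct_mulVec_pos (isHermitian_hankel_iff.2 hh) fun x hx => ?_
    obtain ⟨i, -⟩ := Function.ne_iff.1 hx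
    obtain ⟨A, hrow⟩ : ∃ A : BlockRow q j, ∀ i, A i = star x := ⟨fun _ => star x, fun _ => rfl⟩
    have hA : A ≠ 0 := fun h0 => hx (star_eq_zero.1 ((hrow i.2).symm.trans (congrFun h0 i.2)))
    have htrace : (form s (rowPoly A) (rowPoly A)).trace =
        (q : ℂ) * (star x ⬝ᵥ hankel s 0 j *ᵥ x) := by
      simp [form_rowPoly, trace_mul_mul_conjTranspose, hrow]
    have hpos := hs _ (rowPoly_mem_degreeLT A) (rowPoly_eq_zero_iff.not.2 hA)
    exact pos_of_mul_pos_right (htrace ▸ hpos) q.cast_nonneg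

end BlockMatrices

section Resolvent

theorem isUnit_one_sub_smul_T (j : ℕ) (z : ℂ) : IsUnit (1 - z • T q j).det := by
  let b : Fin (j + 1) × Fin q → (Fin (j + 1))ᵒᵈ := fun p => OrderDual.toDual p.1
  have htri : (1 - z • T q j).BlockTriangular b := by
    intro x y hxy
    have hlt : x.1 < y.1 := hxy
    have hne : (x.1 : ℕ) ≠ y.1 + 1 := by have : (x.1 : ℕ) < y.1 := hlt; omega
    simp [T, hne, Matrix.one_apply_ne fun h => hlt.ne (congrArg Prod.fst h)]
  have hone : ∀ k, (1 - z • T q j).toSquareBlock b k = 1 := by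
    intro k
    ext x y
    have hxy : x.1.1 = y.1.1 := x.2.trans y.2.symm
    simp [Matrix.toSquareBlock_def, T, hxy, Matrix.one_apply, Subtype.ext_iff]
  simp [htri.det_fintype, hone]

theorem T_mul_blockCol (c : ℕ → Mat q) (j : ℕ) :
    T q j * blockCol c j = blockCol (fun i => if i = 0 then 0 else c (i - 1)) j := by
  ext ⟨⟨i, hi⟩, l⟩ k
  rw [Matrix.mul_apply]
  cases i with
  | zero => simp [T, blockCol]
  | succ i =>
    rw [Finset.sum_eq_single (⟨i, by omega⟩, l)]
    · simp [T, blockCol]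
    · rintro ⟨x, y⟩ _ hne
      have : ¬(i = x ∧ l = y) := fun h => hne (Prod.ext (Fin.ext h.1.symm) h.2.symm)
      simp [T, this]
    · simp

theorem R_mul_blockCol (z : ℂ) (c : ℕ → Mat q) (j : ℕ) :
    R q j z * blockCol c j = blockCol (resolventSeq z (c 0) fun i => c (i + 1)) j := by
  have h : (1 - z • T q j) * blockCol (resolventSeq z (c 0) fun i => c (i + 1)) j =
      blockCol c j := by
    rw [Matrix.sub_mul, Matrix.one_mul, Matrix.smul_mul, T_mul_blockCol]
    ext ⟨⟨i, hi⟩, l⟩ k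
    cases i <;> simp [blockCol, resolventSeq]
  rw [R, ← h, Matrix.nonsing_inv_mul_cancel_left _ _ (isUnit_one_sub_smul_T j z)]

theorem R_mul_v (z : ℂ) (j : ℕ) : R q j z * v q j = blockCol (fun i => z ^ i • 1) j := by
  have h : ∀ i, resolventSeq z (1 : Mat q) (fun _ => 0) i = z ^ i • 1 := by
    intro i
    induction i with
    | zero => simp [resolventSeq]
    | succ i ih => rw [resolventSeq, ih, smul_smul, ← pow_succ', add_zero]
  rw [v, R_mul_blockCol]
  exact congrArg (blockCol · j) (funext h)

theorem R_mul_u1 (s : ℕ → Mat q) (z : ℂ) (j : ℕ) :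
    R q j z * u1 s j = -blockCol (resolventSeq z 0 s) j := by
  have h := resolventSeq_neg z (0 : Mat q) s
  simp only [neg_zero] at h
  rw [u1, R_mul_blockCol]
  exact congrArg (blockCol · j) (funext h)

theorem uTilde2_eq (a : ℝ) (s : ℕ → Mat q) (j : ℕ) :
    uTilde2 a s j = blockCol (fun i => if i = 0 then -s 0 else -leftWeighted a s (i - 1)) j := by
  refine congrArg (blockCol · j) (funext fun i => ?_)
  cases i with
  | zero => rfl
  | succ i => simp [leftWeighted, neg_add_eq_sub]

theorem R_mul_uTilde2 (a : ℝ) (s : ℕ → Mat q) (z : ℂ) (j : ℕ) :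
    R q j z * uTilde2 a s j = -blockCol (resolventSeq z (s 0) (leftWeighted a s)) j := by
  rw [uTilde2_eq, R_mul_blockCol]
  exact congrArg (blockCol · j) (funext (resolventSeq_neg z (s 0) (leftWeighted a s)))

theorem R_mul_uTilde2_self (a : ℝ) (s : ℕ → Mat q) (j : ℕ) :
    R q j a * uTilde2 a s j = -blockCol s j := by
  have h : ∀ i, resolventSeq (a : ℂ) (s 0) (leftWeighted a s) i = s i := by
    intro i
    induction i with
    | zero => rfl
    | succ i ih => rw [resolventSeq, ih, leftWeighted, add_sub_cancel]
  rw [R_mul_uTilde2, funext h]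

end Resolvent

section Representers

variable {s : ℕ → Mat q} {a : ℝ} {n j k : ℕ}

/-- The polynomial of degree less than `n` whose moments of order `k < n` are `c k *`, if `s` is
Hankel positive definite: the Riesz representer of the functional `pairing c`. -/
def rieszPoly (s c : ℕ → Mat q) : ℕ → (Mat q)[X]
  | 0 => 0
  | j + 1 => rowPoly ((blockCol c j)ᴴ * (hankel s 0 j)⁻¹)

theorem rieszPoly_mem_degreeLT (s c : ℕ → Mat q) (n : ℕ) : rieszPoly s c n ∈ (Mat q)[X]_n := by
  cases n with
  | zero => exact Submodule.zero_mem _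
  | succ j => exact rowPoly_mem_degreeLT _

theorem moment_rieszPoly (hs : IsPosDefSeq s n) (c : ℕ → Mat q) (hk : k < n) :
    moment s k (rieszPoly s c n) = (c k)ᴴ := by
  obtain ⟨j, rfl⟩ := Nat.exists_eq_succ_of_ne_zero (Nat.ne_zero_of_lt hk)
  have hcol : blockCol (fun k => (moment s k (rieszPoly s c (j + 1)))ᴴ) j = blockCol c j := by
    rw [rieszPoly, ← Matrix.conjTranspose_inj, ← mul_hankel, Matrix.nonsing_inv_mul_cancel_right _ _
      ((Matrix.isUnit_iff_isUnit_det _).1 (posDef_hankel_iff.2 hs).isUnit)]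
  rw [← Matrix.conjTranspose_inj, Matrix.conjTranspose_conjTranspose]
  exact Matrix.ext fun x y => congrFun₂ hcol (⟨k, hk⟩, x) y

theorem pairing_rieszPoly (s c d : ℕ → Mat q) (j : ℕ) :
    pairing d (rieszPoly s c (j + 1)) = (blockCol c j)ᴴ * (hankel s 0 j)⁻¹ * blockCol d j :=
  pairing_rowPoly d _

/-- The monic orthogonal polynomial of degree `n`. -/
def monicOrth (s : ℕ → Mat q) (n : ℕ) : (Mat q)[X] :=
  monomial n 1 - rieszPoly s (fun i => s (n + i)) n

/-- The polynomial of degree less than `n` reproducing the value at `a`. -/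
def kernelPoly (a : ℝ) (s : ℕ → Mat q) (n : ℕ) : (Mat q)[X] :=
  rieszPoly s (fun i => (a : ℂ) ^ i • 1) n

/-- The polynomial of degree less than `n` representing `p ↦ ∫ p σ` with respect to
`(t - a) σ`. -/
def dualPoly (a : ℝ) (s : ℕ → Mat q) (n : ℕ) : (Mat q)[X] := rieszPoly (leftWeighted a s) s n

/-- The orthogonal polynomial of degree `n` with value `1` at `a`. -/
def normOrth (a : ℝ) (s : ℕ → Mat q) (n : ℕ) : (Mat q)[X] := 1 - mulXSub (a : ℂ) (dualPoly a s n)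

theorem monicOrth_mem_degreeLT (s : ℕ → Mat q) (n : ℕ) : monicOrth s n ∈ (Mat q)[X]_(n + 1) :=
  Submodule.sub_mem _
    (mem_degreeLT.2 ((degree_monomial_le _ _).trans_lt (by exact_mod_cast n.lt_succ_self)))
    (degreeLT_mono n.le_succ (rieszPoly_mem_degreeLT _ _ _))

theorem moment_monicOrth (hs : IsPosDefSeq s n) (hh : HermBelow s (2 * n)) (hk : k < n) :
    moment s k (monicOrth s n) = 0 := by
  rw [monicOrth, map_sub, moment_rieszPoly hs _ hk, hh _ (by omega), moment, pairing_monomial,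
    one_mul, sub_self]

theorem coeff_monicOrth (s : ℕ → Mat q) (n : ℕ) : (monicOrth s n).coeff n = 1 := by
  rw [monicOrth, coeff_sub, coeff_monomial_same,
    coeff_eq_zero_of_mem_degreeLT (rieszPoly_mem_degreeLT _ _ _) le_rfl, sub_zero]

theorem kernelPoly_mem_degreeLT (a : ℝ) (s : ℕ → Mat q) (n : ℕ) :
    kernelPoly a s n ∈ (Mat q)[X]_n := rieszPoly_mem_degreeLT _ _ _

theorem moment_kernelPoly (hs : IsPosDefSeq s n) (hk : k < n) :
    moment s k (kernelPoly a s n) = (a : ℂ) ^ k • 1 := by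
  rw [kernelPoly, moment_rieszPoly hs _ hk, Matrix.conjTranspose_smul, Matrix.conjTranspose_one,
    star_pow, Complex.star_def, Complex.conj_ofReal]

theorem moment_leftWeighted_kernelPoly (hs : IsPosDefSeq s (n + 1)) (hk : k < n) :
    moment (leftWeighted a s) k (kernelPoly a s (n + 1)) = 0 := by
  rw [moment_leftWeighted, moment_mulXSub, moment_kernelPoly hs (by omega),
    moment_kernelPoly hs (by omega), smul_smul, ← pow_succ', sub_self]

theorem dualPoly_mem_degreeLT (a : ℝ) (s : ℕ → Mat q) (n : ℕ) :
    dualPoly a s n ∈ (Mat q)[X]_n := rieszPoly_mem_degreeLT _ _ _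

theorem normOrth_mem_degreeLT (a : ℝ) (s : ℕ → Mat q) (n : ℕ) :
    normOrth a s n ∈ (Mat q)[X]_(n + 1) :=
  Submodule.sub_mem _ (one_mem_degreeLT n)
    ((mulXSub_mem_degreeLT_iff _).2 (dualPoly_mem_degreeLT _ _ _))

theorem normOrth_zero (a : ℝ) (s : ℕ → Mat q) : normOrth a s 0 = 1 := by
  rw [normOrth, dualPoly, rieszPoly, map_zero, sub_zero]

theorem evalScalar_normOrth (a : ℝ) (s : ℕ → Mat q) (n : ℕ) :
    evalScalar (a : ℂ) (normOrth a s n) = 1 := by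
  rw [normOrth, map_sub, evalScalar_one, evalScalar_mulXSub_self, sub_zero]

theorem moment_leftWeighted_dualPoly (hs : IsPosDefSeq s n) (hl : IsPosDefSeq (leftWeighted a s) n)
    (hk : k < n) : moment (leftWeighted a s) k (dualPoly a s n) = s k := by
  rw [dualPoly, moment_rieszPoly hl _ hk, hs.herm k (by omega)]

theorem moment_normOrth (hs : IsPosDefSeq s n) (hl : IsPosDefSeq (leftWeighted a s) n)
    (hk : k < n) : moment s k (normOrth a s n) = 0 := by
  rw [normOrth, map_sub, moment_one, ← moment_leftWeighted, moment_leftWeighted_dualPoly hs hl hk,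
    sub_self]

theorem K2_eq (a : ℝ) (s : ℕ → Mat q) (j : ℕ) : K2 a s j = hankel (leftWeighted a s) 0 j := by
  ext x y
  simp [K2, hankel, leftWeighted, neg_add_eq_sub]

theorem MSum_eq (a : ℝ) (s : ℕ → Mat q) (j : ℕ) :
    MSum a s j = evalScalar (a : ℂ) (kernelPoly a s (j + 1)) := by
  rw [← pairing_powers, kernelPoly, pairing_rieszPoly, ← R_mul_v, Matrix.conjTranspose_mul, MSum,
    H1]
  simp only [Matrix.mul_assoc]

theorem LSum_eq (a : ℝ) (s : ℕ → Mat q) (j : ℕ) :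
    LSum a s j = moment s 0 (dualPoly a s (j + 1)) := by
  have hcol : blockCol s j = -(R q j a * uTilde2 a s j) := by rw [R_mul_uTilde2_self, neg_neg]
  simp only [moment, Nat.add_zero]
  rw [dualPoly, pairing_rieszPoly, hcol, LSum, K2_eq, Matrix.conjTranspose_neg,
    Matrix.conjTranspose_mul]
  simp only [Matrix.neg_mul, Matrix.mul_neg, neg_neg, Matrix.mul_assoc]

theorem M_eq (hs : IsPosDefSeq s 1) (a : ℝ) (j : ℕ) :
    M a s j = evalScalar (a : ℂ) (kernelPoly a s (j + 1)) -
      evalScalar (a : ℂ) (kernelPoly a s j) := by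
  cases j with
  | zero =>
    obtain ⟨K, hK⟩ : ∃ K, kernelPoly a s 1 = K • 1 := by
      refine ⟨(kernelPoly a s 1).coeff 0, ?_⟩
      have hdeg := kernelPoly_mem_degreeLT a s 1
      rw [mem_degreeLT, Nat.cast_one, Nat.WithBot.lt_one_iff_le_zero] at hdeg
      conv_lhs => rw [eq_C_of_degree_le_zero hdeg]
      rw [smul_eq_C_mul, mul_one]
    have hinv : K * s 0 = 1 := by
      have h := moment_kernelPoly (a := a) hs zero_lt_one
      rwa [hK, map_smul, moment_one, pow_zero, one_smul] at h
    rw [hK, kernelPoly, rieszPoly, map_zero, sub_zero, map_smul, evalScalar_one, smul_eq_mul,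
      mul_one]
    exact Matrix.inv_eq_left_inv hinv
  | succ j => rw [M, MSum_eq, MSum_eq]

theorem L_eq (a : ℝ) (s : ℕ → Mat q) (j : ℕ) :
    L a s j = moment s 0 (dualPoly a s (j + 1)) - moment s 0 (dualPoly a s j) := by
  cases j with
  | zero => rw [L, LSum_eq, dualPoly, dualPoly, rieszPoly, map_zero, sub_zero]
  | succ j => rw [L, LSum_eq, LSum_eq]

theorem kernelPoly_succ (hs : IsPosDefSeq s (j + 1)) (hl : IsPosDefSeq (leftWeighted a s) j) :
    kernelPoly a s (j + 1) = kernelPoly a s j + M a s j • normOrth a s j := by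
  have hsj := hs.mono j.le_succ
  rw [← sub_eq_iff_eq_add', ← sub_eq_zero]
  obtain ⟨e, he, heq⟩ := exists_eq_mulXSub (z := (a : ℂ))
    (p := kernelPoly a s (j + 1) - kernelPoly a s j - M a s j • normOrth a s j)
    (Submodule.sub_mem _ (Submodule.sub_mem _ (kernelPoly_mem_degreeLT _ _ _)
      (degreeLT_mono j.le_succ (kernelPoly_mem_degreeLT _ _ _)))
      (Submodule.smul_mem _ _ (normOrth_mem_degreeLT _ _ _)))
    (by rw [map_sub, map_sub, map_smul, evalScalar_normOrth, M_eq (hs.mono (by omega)),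
      smul_eq_mul, mul_one, sub_self])
  have he0 : e = 0 := hl.pos.eq_zero_of_moment he fun k hk => by
    rw [moment_leftWeighted, ← heq, map_sub, map_sub, map_smul, moment_kernelPoly hs (by omega),
      moment_kernelPoly hsj hk, moment_normOrth hsj hl hk, sub_self, smul_zero, sub_zero]
  rw [heq, he0, map_zero]

theorem dualPoly_succ (hs : IsPosDefSeq s (j + 1)) (hl : IsPosDefSeq (leftWeighted a s) (j + 1)) :
    dualPoly a s (j + 1) = dualPoly a s j + L a s j • kernelPoly a s (j + 1) := by
  rw [← sub_eq_iff_eq_add', ← sub_eq_zero]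
  have hmem := Submodule.sub_mem _ (Submodule.sub_mem _ (dualPoly_mem_degreeLT a s (j + 1))
    (degreeLT_mono j.le_succ (dualPoly_mem_degreeLT a s j)))
    (Submodule.smul_mem _ (L a s j) (kernelPoly_mem_degreeLT a s (j + 1)))
  have hmom0 : moment s 0
      (dualPoly a s (j + 1) - dualPoly a s j - L a s j • kernelPoly a s (j + 1)) = 0 := by
    rw [map_sub, map_sub, map_smul, moment_kernelPoly hs j.succ_pos, pow_zero, one_smul,
      smul_eq_mul, mul_one, L_eq, sub_self]
  refine hs.pos.eq_zero_of_moment hmem fun k hk => moment_eq_zero_of_mulXSub (w := a) (j := j) hmom0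
    (fun k hk => ?_) k (by omega)
  rw [← moment_leftWeighted, map_sub, map_sub, map_smul, moment_leftWeighted_kernelPoly hs hk,
    moment_leftWeighted_dualPoly hs hl (by omega),
    moment_leftWeighted_dualPoly (hs.mono j.le_succ) (hl.mono j.le_succ) hk, sub_self, smul_zero,
    sub_zero]

theorem normOrth_succ (hs : IsPosDefSeq s (j + 1)) (hl : IsPosDefSeq (leftWeighted a s) (j + 1)) :
    normOrth a s (j + 1) =
      normOrth a s j - L a s j • mulXSub (a : ℂ) (kernelPoly a s (j + 1)) := by
  rw [normOrth, dualPoly_succ hs hl, map_add, map_smul, ← sub_sub, normOrth]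

theorem conjTranspose_MSum (hs : IsPosDefSeq s (j + 1)) : (MSum a s j)ᴴ = MSum a s j := by
  have hinv := (posDef_hankel_iff.2 hs).1.inv
  simp only [MSum, H1, Matrix.conjTranspose_mul, Matrix.conjTranspose_conjTranspose, hinv.eq,
    Matrix.mul_assoc]

theorem conjTranspose_LSum (hl : IsPosDefSeq (leftWeighted a s) (j + 1)) :
    (LSum a s j)ᴴ = LSum a s j := by
  have hinv := (posDef_hankel_iff.2 hl).1.inv
  simp only [LSum, K2_eq, Matrix.conjTranspose_mul, Matrix.conjTranspose_conjTranspose, hinv.eq,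
    Matrix.mul_assoc]

theorem conjTranspose_M (hs : IsPosDefSeq s (j + 1)) : (M a s j)ᴴ = M a s j := by
  cases j with
  | zero => rw [M, Matrix.conjTranspose_nonsing_inv, hs.herm 0 (by omega)]
  | succ j =>
    rw [M, Matrix.conjTranspose_sub, conjTranspose_MSum hs, conjTranspose_MSum (hs.mono (by omega))]

theorem conjTranspose_L (hl : IsPosDefSeq (leftWeighted a s) (j + 1)) : (L a s j)ᴴ = L a s j := by
  cases j with
  | zero => rw [L, conjTranspose_LSum hl]
  | succ j =>
    rw [L, Matrix.conjTranspose_sub, conjTranspose_LSum hl, conjTranspose_LSum (hl.mono (by omega))]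

end Representers

section SqrtPoly

/-- The pair `(p, r)` stands for the polynomial `p(t) + √(t - a) r(t)` in `√(t - a)`. -/
abbrev SqrtPoly (q : ℕ) : Type := (Mat q)[X] × (Mat q)[X]

/-- Multiplication by `√(t - a)`. -/
def sqrtMul (a : ℝ) : SqrtPoly q →ₗ[Mat q] SqrtPoly q :=
  (mulXSub (a : ℂ) ∘ₗ LinearMap.snd _ _ _).prod (LinearMap.fst _ _ _)

/-- The polynomials of degree less than `N` in `√(t - a)`. -/
def sqrtDegreeLT (q N : ℕ) : Submodule (Mat q) (SqrtPoly q) :=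
  ((Mat q)[X]_((N + 1) / 2)).prod ((Mat q)[X]_(N / 2))

/-- The value at the point `√(t - a) = y`, that is `t = a + y²`. -/
def sqrtEval (a : ℝ) (y : ℂ) : SqrtPoly q →ₗ[Mat q] Mat q :=
  (evalScalar (a + y ^ 2)).coprod (y • evalScalar (a + y ^ 2))

/-- The form of the even measure of which `σ` is the image under `u ↦ a + u²`. -/
def sqrtForm (a : ℝ) (s : ℕ → Mat q) (e f : SqrtPoly q) : Mat q :=
  form s e.1 f.1 + form (leftWeighted a s) e.2 f.2

/-- The function of the second kind, at the point `y`, for the even measure of which `σ` is the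
image under `u ↦ a + u²`. -/
def sqrtRemainder (a : ℝ) (s : ℕ → Mat q) (y : ℂ) (W : Mat q) : SqrtPoly q →ₗ[Mat q] Mat q :=
  (y • remainder s (a + y ^ 2) W).coprod (remainder s (a + y ^ 2) W ∘ₗ mulXSub (a : ℂ))

variable {a : ℝ} {s : ℕ → Mat q} {y : ℂ} {W : Mat q} {e f : SqrtPoly q} {k n N : ℕ}

theorem sqrtDegreeLT_mono {m : ℕ} (h : m ≤ n) : sqrtDegreeLT q m ≤ sqrtDegreeLT q n :=
  Submodule.prod_mono (degreeLT_mono (by omega)) (degreeLT_mono (by omega))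

theorem exists_eq_sqrtMul_sub (hf : f ∈ sqrtDegreeLT q (N + 1)) (h0 : sqrtEval a y f = 0) :
    ∃ e ∈ sqrtDegreeLT q N, f = sqrtMul a e - y • e := by
  obtain ⟨p, r⟩ := f
  obtain ⟨hp, hr⟩ := hf
  have hr' : r ∈ (Mat q)[X]_((N + 1) / 2) := hr
  have hw : evalScalar ((a : ℂ) + y ^ 2) (p + y • r) = 0 := by
    rw [map_add, map_central_smul]
    exact h0
  obtain ⟨g, hg, heq⟩ := exists_eq_mulXSub (n := N / 2) (Submodule.add_mem _
    (degreeLT_mono (by omega) hp)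
    (Submodule.smul_of_tower_mem _ y (degreeLT_mono (by omega) hr'))) hw
  refine ⟨(r + y • g, g), ⟨Submodule.add_mem _ hr'
    (Submodule.smul_of_tower_mem _ y (degreeLT_mono (by omega) hg)), hg⟩, ?_⟩
  rw [mulXSub_eq_add _ (a : ℂ), ← eq_sub_iff_add_eq] at heq
  refine Prod.ext ?_ (add_sub_cancel_right r (y • g)).symm
  rw [heq]
  change _ = mulXSub (a : ℂ) g - y • (r + y • g)
  rw [sub_add_cancel_left, neg_smul, smul_add, smul_smul, pow_two]
  abel

theorem sqrtRemainder_sqrtMul_sub (e : SqrtPoly q) :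
    sqrtRemainder a s y W (sqrtMul a e - y • e) = moment s 0 e.1 := by
  change y • remainder s _ W (mulXSub (a : ℂ) e.2 - y • e.1) +
    remainder s _ W (mulXSub (a : ℂ) (e.1 - y • e.2)) = _
  simp only [map_sub, map_central_smul, remainder_mulXSub, add_sub_cancel_left, smul_sub, smul_add,
    smul_smul, pow_two, mul_assoc]
  abel

theorem sqrtForm_sqrtMul_left : sqrtForm a s (sqrtMul a e) f = sqrtForm a s e (sqrtMul a f) := by
  change form s (mulXSub (a : ℂ) e.2) f.1 + form (leftWeighted a s) e.1 f.2 =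
    form s e.1 (mulXSub (a : ℂ) f.2) + form (leftWeighted a s) e.2 f.1
  rw [form_leftWeighted, form_leftWeighted, form_mulXSub_comm (p := e.1), add_comm]

theorem sqrtForm_sub_left (e e' f : SqrtPoly q) :
    sqrtForm a s (e - e') f = sqrtForm a s e f - sqrtForm a s e' f := by
  simp only [sqrtForm, Prod.fst_sub, Prod.snd_sub, form_sub_left]
  abel

theorem sqrtForm_smul_left (Y : Mat q) (e f : SqrtPoly q) :
    sqrtForm a s (Y • e) f = Y * sqrtForm a s e f := by
  simp only [sqrtForm, Prod.smul_fst, Prod.smul_snd, form_smul_left, mul_add]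

theorem sqrtForm_central_smul_left (z : ℂ) (e f : SqrtPoly q) :
    sqrtForm a s (z • e) f = z • sqrtForm a s e f := by
  simp only [sqrtForm, Prod.smul_fst, Prod.smul_snd, form_central_smul_left, smul_add]

theorem sqrtForm_add_right (e f f' : SqrtPoly q) :
    sqrtForm a s e (f + f') = sqrtForm a s e f + sqrtForm a s e f' := by
  simp only [sqrtForm, Prod.fst_add, Prod.snd_add, form_add_right]
  abel

theorem sqrtForm_smul_one_right (e : SqrtPoly q) (Y : Mat q) :
    sqrtForm a s e (Y • (1, 0)) = moment s 0 e.1 * Yᴴ := by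
  simp [sqrtForm, form, pairing_one]

theorem sqrtForm_eq_zero_of_sqrtMul_sub (h0 : moment s 0 e.1 = 0)
    (h : ∀ d ∈ sqrtDegreeLT q k, sqrtForm a s (sqrtMul a e - y • e) d = 0) :
    ∀ i ≤ k + 1, ∀ d ∈ sqrtDegreeLT q i, sqrtForm a s e d = 0 := by
  intro i
  induction i with
  | zero =>
    rintro - ⟨d₁, d₂⟩ ⟨h₁, h₂⟩
    have hd₁ : d₁ = 0 := by simpa using mem_degreeLT.1 h₁
    have hd₂ : d₂ = 0 := by simpa using mem_degreeLT.1 h₂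
    simp [sqrtForm, hd₁, hd₂, form]
  | succ i ih =>
    intro hi d hd
    set c := sqrtEval a 0 d
    have hone : ((1, 0) : SqrtPoly q) ∈ sqrtDegreeLT q (i + 1) :=
      ⟨degreeLT_mono (by omega) (one_mem_degreeLT 0), Submodule.zero_mem _⟩
    obtain ⟨d', hd', heq⟩ := exists_eq_sqrtMul_sub (a := a) (y := 0)
      (Submodule.sub_mem _ hd (Submodule.smul_mem _ c hone)) (by
        simp [c, sqrtEval, evalScalar_one])
    rw [zero_smul, sub_zero, sub_eq_iff_eq_add'] at heq
    have hU : sqrtForm a s e (sqrtMul a d') = 0 := by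
      have hsplit := h d' (sqrtDegreeLT_mono (by omega) hd')
      rwa [sqrtForm_sub_left, sqrtForm_central_smul_left, ih (by omega) d' hd', smul_zero,
        sub_zero, sqrtForm_sqrtMul_left] at hsplit
    rw [heq, sqrtForm_add_right, sqrtForm_smul_one_right, h0, zero_mul, hU, zero_add]

/-- The sequence `s₀, …, s_{N-1}` is Stieltjes positive definite on `[a, ∞)`; equivalently,
`sqrtForm a s` is positive definite in degrees less than `N`. -/
structure IsStieltjesPosDef (a : ℝ) (s : ℕ → Mat q) (N : ℕ) : Prop where
  herm : HermBelow s N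
  pos : PosDefBelow s ((N + 1) / 2)
  posLeft : PosDefBelow (leftWeighted a s) (N / 2)

theorem IsStieltjesPosDef.mono (h : IsStieltjesPosDef a s N) (hn : n ≤ N) :
    IsStieltjesPosDef a s n :=
  ⟨h.herm.mono hn, h.pos.mono (by omega), h.posLeft.mono (by omega)⟩

theorem IsStieltjesPosDef.isPosDefSeq (h : IsStieltjesPosDef a s N) (hn : 2 * n ≤ N + 1) :
    IsPosDefSeq s n :=
  ⟨h.herm.mono (by omega), h.pos.mono (by omega)⟩

theorem IsStieltjesPosDef.hermBelow_leftWeighted (h : IsStieltjesPosDef a s N) :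
    HermBelow (leftWeighted a s) (N - 1) := by
  cases N with
  | zero => exact fun k hk => absurd hk k.not_lt_zero
  | succ N => exact h.herm.leftWeighted a

theorem IsStieltjesPosDef.isPosDefSeq_leftWeighted (h : IsStieltjesPosDef a s N)
    (hn : 2 * n ≤ N) : IsPosDefSeq (leftWeighted a s) n :=
  ⟨h.hermBelow_leftWeighted.mono (by omega), h.posLeft.mono (by omega)⟩

theorem IsStieltjesPosDef.conjTranspose_sqrtForm (h : IsStieltjesPosDef a s N)
    (he : e ∈ sqrtDegreeLT q N) (hf : f ∈ sqrtDegreeLT q N) :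
    (sqrtForm a s e f)ᴴ = sqrtForm a s f e := by
  rw [sqrtForm, Matrix.conjTranspose_add, h.herm.conjTranspose_form he.1 hf.1 (by omega),
    h.hermBelow_leftWeighted.conjTranspose_form he.2 hf.2 (by omega), sqrtForm]

theorem IsStieltjesPosDef.trace_sqrtForm_pos (h : IsStieltjesPosDef a s N)
    (he : e ∈ sqrtDegreeLT q N) (hne : e ≠ 0) : 0 < (sqrtForm a s e e).trace := by
  rw [sqrtForm, Matrix.trace_add]
  obtain hne | hne := not_and_or.1 (mt (fun h => Prod.ext h.1 h.2) hne)
  · exact add_pos_of_pos_of_nonneg (h.pos _ he.1 hne) (h.posLeft.posSemidefBelow _ he.2)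
  · exact add_pos_of_nonneg_of_pos (h.pos.posSemidefBelow _ he.1) (h.posLeft _ he.2 hne)

theorem IsStieltjesPosDef.eq_zero (h : IsStieltjesPosDef a s N) (he : e ∈ sqrtDegreeLT q N)
    (h0 : sqrtForm a s e e = 0) : e = 0 := by
  by_contra hne
  exact (h.trace_sqrtForm_pos he hne).ne' (by rw [h0, Matrix.trace_zero])

/-- The pair `φ` is an orthogonal polynomial of degree `N` in `√(t - a)` for `sqrtForm a s`, with
invertible leading coefficient. -/
structure IsSqrtOrth (a : ℝ) (s : ℕ → Mat q) (N : ℕ) (φ : SqrtPoly q) : Prop where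
  mem : φ ∈ sqrtDegreeLT q (N + 1)
  orth : ∀ e ∈ sqrtDegreeLT q N, sqrtForm a s φ e = 0
  smul_eq_zero : ∀ Y : Mat q, Y • φ = 0 → Y = 0

theorem isSqrtOrth_left {p : (Mat q)[X]} (hp : p ∈ (Mat q)[X]_(n + 1))
    (h0 : ∀ k < n, moment s k p = 0) (hY : ∀ Y : Mat q, Y • p = 0 → Y = 0) :
    IsSqrtOrth a s (2 * n) (p, 0) where
  mem := ⟨degreeLT_mono (by omega) hp, Submodule.zero_mem _⟩
  orth e he := by
    rw [sqrtForm, form_zero_left, add_zero]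
    exact form_eq_zero (n := n) (degreeLT_mono (by omega) he.1) h0
  smul_eq_zero Y h := hY Y (congrArg Prod.fst h)

theorem isSqrtOrth_right {r : (Mat q)[X]} (hr : r ∈ (Mat q)[X]_(n + 1))
    (h0 : ∀ k < n, moment (leftWeighted a s) k r = 0) (hY : ∀ Y : Mat q, Y • r = 0 → Y = 0) :
    IsSqrtOrth a s (2 * n + 1) (0, r) where
  mem := ⟨Submodule.zero_mem _, degreeLT_mono (by omega) hr⟩
  orth e he := by
    rw [sqrtForm, form_zero_left, zero_add]
    exact form_eq_zero (n := n) (degreeLT_mono (by omega) he.2) h0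
  smul_eq_zero Y h := hY Y (congrArg Prod.snd h)

theorem isUnit_of_forall_mul_eq_zero {A : Mat q} (h : ∀ Y : Mat q, Y * A = 0 → Y = 0) :
    IsUnit A :=
  IsArtinianRing.isUnit_iff_isRightRegular.2 fun B C hBC =>
    sub_eq_zero.1 (h _ (by rw [sub_mul, sub_eq_zero]; exact hBC))

/-- The point `y` is not in the numerical range of multiplication by `√(t - a)` in degrees less
than `N`. -/
def NotMemSqrtRange (a : ℝ) (s : ℕ → Mat q) (N : ℕ) (y : ℂ) : Prop :=
  ∀ e ∈ sqrtDegreeLT q N, sqrtForm a s (sqrtMul a e - y • e) e = 0 → e = 0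

theorem IsSqrtOrth.isUnit_sqrtEval {φ : SqrtPoly q} (hφ : IsSqrtOrth a s N φ)
    (hy : NotMemSqrtRange a s N y) : IsUnit (sqrtEval a y φ) := by
  refine isUnit_of_forall_mul_eq_zero fun Y hY => hφ.smul_eq_zero Y ?_
  obtain ⟨e, he, heq⟩ := exists_eq_sqrtMul_sub (a := a) (y := y) (Submodule.smul_mem _ Y hφ.mem)
    (by rw [map_smul, smul_eq_mul, hY])
  rw [heq, hy e he (by rw [← heq, sqrtForm_smul_left, hφ.orth e he, mul_zero]), map_zero,
    smul_zero, sub_zero]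

theorem IsSqrtOrth.exists_sub_smul_eq {φ : SqrtPoly q} (hφ : IsSqrtOrth a s N φ)
    (hy : NotMemSqrtRange a s N y) (hf : f ∈ sqrtDegreeLT q (N + 1)) :
    ∃ Z : Mat q, ∃ e ∈ sqrtDegreeLT q N, f - Z • φ = sqrtMul a e - y • e := by
  obtain ⟨u, hu⟩ := hφ.isUnit_sqrtEval hy
  refine ⟨sqrtEval a y f * ↑u⁻¹, exists_eq_sqrtMul_sub
    (Submodule.sub_mem _ hf (Submodule.smul_mem _ _ hφ.mem)) ?_⟩
  rw [map_sub, map_smul, smul_eq_mul, ← hu, Units.inv_mul_cancel_right, sub_self]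

theorem IsSqrtOrth.exists_eq_smul {φ ψ : SqrtPoly q} (hφ : IsSqrtOrth a s N φ)
    (hψ : IsSqrtOrth a s N ψ) (hy : NotMemSqrtRange a s N y) : ∃ Z : Mat q, ψ = Z • φ := by
  obtain ⟨Z, e, he, heq⟩ := hφ.exists_sub_smul_eq hy hψ.mem
  refine ⟨Z, sub_eq_zero.1 ?_⟩
  rw [heq, hy e he (by rw [← heq, sqrtForm_sub_left, sqrtForm_smul_left, hψ.orth e he,
    hφ.orth e he, mul_zero, sub_zero]), map_zero, smul_zero, sub_zero]

theorem IsSqrtOrth.isUnit_sqrtRemainder {φ ψ : SqrtPoly q} (hs : IsStieltjesPosDef a s N)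
    (hφ : IsSqrtOrth a s N φ) (hψ : IsSqrtOrth a s k ψ) (hk : k < N)
    (hy : NotMemSqrtRange a s N y) (hW : sqrtRemainder a s y W φ = 0) :
    IsUnit (sqrtRemainder a s y W ψ) := by
  refine isUnit_of_forall_mul_eq_zero fun Y hY => hψ.smul_eq_zero Y ?_
  have hψN : ψ ∈ sqrtDegreeLT q N := sqrtDegreeLT_mono (by omega) hψ.mem
  obtain ⟨Z, e, he, heq⟩ := hφ.exists_sub_smul_eq hy
    (Submodule.smul_mem _ Y (sqrtDegreeLT_mono N.le_succ hψN))
  have hmom : moment s 0 e.1 = 0 := by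
    rw [← sqrtRemainder_sqrtMul_sub (a := a) (y := y) (W := W), ← heq, map_sub, map_smul, map_smul,
      hW, smul_eq_mul, hY, smul_zero, sub_zero]
  have horth : ∀ d ∈ sqrtDegreeLT q k, sqrtForm a s (sqrtMul a e - y • e) d = 0 := fun d hd => by
    rw [← heq, sqrtForm_sub_left, sqrtForm_smul_left, sqrtForm_smul_left, hψ.orth d hd,
      hφ.orth d (sqrtDegreeLT_mono hk.le hd), mul_zero, mul_zero, sub_zero]
  have hψe : sqrtForm a s ψ e = 0 := by
    rw [← hs.conjTranspose_sqrtForm he hψN,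
      sqrtForm_eq_zero_of_sqrtMul_sub hmom horth _ le_rfl ψ hψ.mem, Matrix.conjTranspose_zero]
  have he0 : e = 0 := hy e he (by
    rw [← heq, sqrtForm_sub_left, sqrtForm_smul_left, sqrtForm_smul_left, hψe, hφ.orth e he,
      mul_zero, mul_zero, sub_zero])
  rw [he0, map_zero, smul_zero, sub_zero, sub_eq_zero] at heq
  have hYψ := Submodule.smul_mem _ Y hψN
  refine hs.eq_zero hYψ ?_
  nth_rewrite 1 [heq]
  rw [sqrtForm_smul_left, hφ.orth _ hYψ, mul_zero]

end SqrtPoly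

section NumericalRange

theorem sq_le_of_forall_quadratic_nonneg {κ α β y : ℝ} (hα : 0 ≤ α) (h0 : 0 < α + β)
    (hκ : 0 ≤ κ) (h : ∀ x : ℝ, 0 ≤ κ * α + x * (y * (α + β)) + x ^ 2 * β) : y ^ 2 ≤ κ := by
  obtain rfl | hα := hα.eq_or_lt
  · have hy : y ^ 2 * β ≤ 0 := by linarith [h (-(y / 2))]
    exact (nonpos_of_mul_nonpos_left hy (by linarith)).trans hκ
  · exact le_of_mul_le_mul_right (by linarith [h (-y)]) hα

theorem exists_ofReal_sq_le_of_forall_quadratic_nonneg {κ : ℝ} {α β y : ℂ} (hα : 0 ≤ α)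
    (hβ : 0 ≤ β) (h0 : 0 < α + β) (hκ : 0 ≤ κ)
    (h : ∀ x : ℝ, 0 ≤ κ * α + x * (y * (α + β)) + (x ^ 2 : ℝ) * β) :
    ∃ x : ℝ, y = x ∧ x ^ 2 ≤ κ := by
  obtain ⟨α, rfl⟩ : ∃ t : ℝ, α = t := ⟨_, Complex.eq_re_of_ofReal_le hα⟩
  obtain ⟨β, rfl⟩ : ∃ t : ℝ, β = t := ⟨_, Complex.eq_re_of_ofReal_le hβ⟩
  norm_cast at hα h0
  obtain ⟨x, rfl⟩ : ∃ x : ℝ, y = x := by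
    have hy : y.im * (α + β) = 0 := by simpa using (Complex.le_def.1 (h 1)).2.symm
    exact ⟨y.re, Complex.ext rfl (eq_zero_of_ne_zero_of_mul_right_eq_zero h0.ne' hy)⟩
  exact ⟨x, rfl, sq_le_of_forall_quadratic_nonneg hα h0 hκ fun t => by exact_mod_cast h t⟩

variable {a b : ℝ} {s : ℕ → Mat q} {y : ℂ} {p r : (Mat q)[X]} {n N : ℕ}

theorem form_add_smul_self (x : ℝ) : form s (p + (x : ℂ) • r) (p + (x : ℂ) • r) =
    form s p p + (x : ℂ) • (form s p r + form s r p) + ((x ^ 2 : ℝ) : ℂ) • form s r r := by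
  simp only [form_add_left, form_add_right, form_central_smul_left, form_central_smul_right,
    Complex.star_def, Complex.conj_ofReal, smul_add, smul_smul, pow_two, Complex.ofReal_mul]
  abel

theorem trace_form_leftWeighted_le (h : PosSemidefBelow (rightWeighted b s) n)
    (hp : p ∈ (Mat q)[X]_n) :
    (form (leftWeighted a s) p p).trace ≤ ((b - a : ℝ) : ℂ) * (form s p p).trace := by
  rw [← smul_eq_mul, ← Matrix.trace_smul, ← form_leftWeighted_add_form_rightWeighted,
    Matrix.trace_add]
  exact le_add_of_nonneg_right (h p hp)

theorem notMemSqrtRange_of_forall_quadratic_nonneg (hab : a ≤ b) (hs : IsStieltjesPosDef a s N)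
    (hy : (a + y ^ 2 : ℂ) ∉ Complex.ofReal '' Set.Icc a b)
    (h : ∀ e ∈ sqrtDegreeLT q N, ∃ α β : ℂ, 0 ≤ α ∧ 0 ≤ β ∧ (sqrtForm a s e e).trace = α + β ∧
      ∀ x : ℝ, 0 ≤ ((b - a : ℝ) : ℂ) * α + x * (sqrtForm a s (sqrtMul a e) e).trace +
        (x ^ 2 : ℝ) * β) : NotMemSqrtRange a s N y := by
  intro e he hey
  by_contra hne
  obtain ⟨α, β, hα, hβ, hαβ, hx⟩ := h e he
  rw [sqrtForm_sub_left, sqrtForm_central_smul_left, sub_eq_zero] at hey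
  rw [hey, Matrix.trace_smul, hαβ] at hx
  obtain ⟨x, rfl, hxκ⟩ := exists_ofReal_sq_le_of_forall_quadratic_nonneg hα hβ
    (by rw [← hαβ]; exact hs.trace_sqrtForm_pos he hne) (sub_nonneg.2 hab) hx
  exact hy ⟨a + x ^ 2, ⟨by linarith [sq_nonneg x], by linarith⟩, by push_cast; rfl⟩

theorem notMemSqrtRange_even (hab : a ≤ b) (hs : IsStieltjesPosDef a s (2 * n))
    (hb : PosSemidefBelow (rightWeighted b s) n)
    (hy : (a + y ^ 2 : ℂ) ∉ Complex.ofReal '' Set.Icc a b) : NotMemSqrtRange a s (2 * n) y := by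
  refine notMemSqrtRange_of_forall_quadratic_nonneg hab hs hy fun e he => ?_
  have hp : e.1 ∈ (Mat q)[X]_n := degreeLT_mono (by omega) he.1
  have hr : e.2 ∈ (Mat q)[X]_n := degreeLT_mono (by omega) he.2
  have hleft : PosSemidefBelow (leftWeighted a s) n :=
    (hs.posLeft.mono (by omega)).posSemidefBelow
  refine ⟨(form s e.1 e.1).trace, (form (leftWeighted a s) e.2 e.2).trace,
    hs.pos.posSemidefBelow _ he.1, hleft _ hr, by rw [sqrtForm, Matrix.trace_add], fun x => ?_⟩
  have hcross : sqrtForm a s (sqrtMul a e) e =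
      form (leftWeighted a s) e.1 e.2 + form (leftWeighted a s) e.2 e.1 := by
    rw [form_leftWeighted (p := e.2), add_comm]
    rfl
  calc
    0 ≤ (form (leftWeighted a s) (e.1 + (x : ℂ) • e.2) (e.1 + (x : ℂ) • e.2)).trace :=
      hleft _ (Submodule.add_mem _ hp (Submodule.smul_of_tower_mem _ _ hr))
    _ ≤ _ := by
      rw [form_add_smul_self, ← hcross]
      simp only [Matrix.trace_add, Matrix.trace_smul, smul_eq_mul]
      gcongr
      exact trace_form_leftWeighted_le hb hp

theorem notMemSqrtRange_odd (hab : a ≤ b) (hs : IsStieltjesPosDef a s (2 * n + 1))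
    (hb : PosSemidefBelow (rightWeighted b (leftWeighted a s)) n)
    (hy : (a + y ^ 2 : ℂ) ∉ Complex.ofReal '' Set.Icc a b) :
    NotMemSqrtRange a s (2 * n + 1) y := by
  refine notMemSqrtRange_of_forall_quadratic_nonneg hab hs hy fun e he => ?_
  have hp : e.1 ∈ (Mat q)[X]_(n + 1) := degreeLT_mono (by omega) he.1
  have hr : e.2 ∈ (Mat q)[X]_n := degreeLT_mono (by omega) he.2
  have hpos : PosSemidefBelow s (n + 1) := (hs.pos.mono (by omega)).posSemidefBelow
  refine ⟨(form (leftWeighted a s) e.2 e.2).trace, (form s e.1 e.1).trace,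
    hs.posLeft.posSemidefBelow _ he.2, hpos _ hp,
    by rw [sqrtForm, Matrix.trace_add, add_comm], fun x => ?_⟩
  have hcross : sqrtForm a s (sqrtMul a e) e =
      form s (mulXSub (a : ℂ) e.2) e.1 + form s e.1 (mulXSub (a : ℂ) e.2) := by
    rw [← form_mulXSub_comm (p := e.1), ← form_leftWeighted (p := e.1)]
    rfl
  calc
    0 ≤ (form s (mulXSub (a : ℂ) e.2 + (x : ℂ) • e.1)
        (mulXSub (a : ℂ) e.2 + (x : ℂ) • e.1)).trace :=
      hpos _ (Submodule.add_mem _ ((mulXSub_mem_degreeLT_iff _).2 hr)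
        (Submodule.smul_of_tower_mem _ _ hp))
    _ ≤ _ := by
      rw [form_add_smul_self, ← hcross, ← form_leftWeighted_leftWeighted]
      simp only [Matrix.trace_add, Matrix.trace_smul, smul_eq_mul]
      gcongr
      exact trace_form_leftWeighted_le hb hr

end NumericalRange

section ExtremalSolutions

variable {b : ℝ} {s : ℕ → Mat q}

theorem monicOrth_zero (s : ℕ → Mat q) : monicOrth s 0 = 1 := by
  rw [monicOrth, rieszPoly, sub_zero, monomial_zero_one]

theorem rowPoly_appendId_Y1 (s : ℕ → Mat q) (j : ℕ) :
    rowPoly (appendId (-((Y1 s j)ᴴ * (H1 s j)⁻¹))) = monicOrth s (j + 1) :=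
  rowPoly_appendId_neg _

theorem P1_eq (s : ℕ → Mat q) (n : ℕ) (z : ℂ) : P1 s n z = evalScalar z (monicOrth s n) := by
  cases n with
  | zero => rw [P1, monicOrth_zero, evalScalar_one]
  | succ j =>
    rw [P1, Matrix.mul_assoc, R_mul_v, ← pairing_rowPoly, rowPoly_appendId_Y1, pairing_powers]

theorem Q1_eq (s : ℕ → Mat q) (n : ℕ) (z : ℂ) : Q1 s n z = remainder s z 0 (monicOrth s n) := by
  cases n with
  | zero => rw [Q1, monicOrth_zero, remainder_one]
  | succ j =>
    rw [Q1, Matrix.mul_assoc, R_mul_u1, Matrix.mul_neg, neg_neg, ← pairing_rowPoly,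
      rowPoly_appendId_Y1, remainder]

theorem YTilde2_eq (a : ℝ) (s : ℕ → Mat q) (j : ℕ) : YTilde2 a s j = Y1 (leftWeighted a s) j :=
  congrArg (blockCol · j) (funext fun i => by
    rw [leftWeighted, neg_smul, neg_add_eq_sub, Nat.add_right_comm (j + 1)])

theorem Gamma2_eq (a : ℝ) (s : ℕ → Mat q) : Gamma2 a s = P1 (leftWeighted a s) := by
  funext n z
  cases n with
  | zero => rfl
  | succ j => rw [Gamma2, YTilde2_eq, K2_eq, P1, H1]

theorem Theta2_eq (a : ℝ) (s : ℕ → Mat q) (n : ℕ) (z : ℂ) :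
    Theta2 a s n z = -remainder s z 0 (mulXSub (a : ℂ) (monicOrth (leftWeighted a s) n)) := by
  rw [← remainder_leftWeighted, smul_zero, zero_add]
  cases n with
  | zero => rw [Theta2, monicOrth_zero, remainder_one]
  | succ j =>
    rw [Theta2, YTilde2_eq, K2_eq, ← H1, Matrix.mul_assoc, R_mul_uTilde2, Matrix.mul_neg,
      ← pairing_rowPoly, rowPoly_appendId_Y1, remainder]

theorem YTilde1_eq (b : ℝ) (s : ℕ → Mat q) (j : ℕ) :
    YTilde1 b s j = Y1 (rightWeighted b s) j :=
  congrArg (blockCol · j) (funext fun i => by rw [rightWeighted, Nat.add_right_comm (j + 1)])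

theorem Gamma1_eq (b : ℝ) (s : ℕ → Mat q) : Gamma1 b s = P1 (rightWeighted b s) := by
  funext n z
  cases n with
  | zero => rfl
  | succ j =>
    rw [Gamma1, YTilde1_eq, P1]
    rfl

theorem v_mul (q j : ℕ) (A : Mat q) :
    v q j * A = blockCol (fun i => if i = 0 then A else 0) j := by
  ext ⟨⟨i, hi⟩, l⟩ k
  cases i <;> simp [v, blockCol, Matrix.mul_apply, Matrix.one_apply]

theorem uTilde1_eq (b : ℝ) (s : ℕ → Mat q) (j : ℕ) :
    uTilde1 b s j = v q j * s 0 + u1 (rightWeighted b s) j := by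
  rw [v_mul]
  ext ⟨⟨i, hi⟩, l⟩ k
  cases i <;> simp [uTilde1, u1, blockCol, rightWeighted]

theorem Theta1_eq (b : ℝ) (s : ℕ → Mat q) (n : ℕ) (z : ℂ) :
    Theta1 b s n z = P1 (rightWeighted b s) n z * s 0 - Q1 (rightWeighted b s) n z := by
  cases n with
  | zero => rw [Theta1, P1, Q1, one_mul, sub_zero]
  | succ j =>
    rw [← Gamma1_eq, Gamma1, Theta1, uTilde1_eq, Q1, Matrix.mul_add, ← Matrix.mul_assoc _ _ (s 0),
      sub_neg_eq_add, YTilde1_eq]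
    rfl

theorem H2_eq (a b : ℝ) (s : ℕ → Mat q) (j : ℕ) : H2 a b s j = K2 a (rightWeighted b s) j := by
  ext x y
  simp only [H2, K2, hankel, rightWeighted, Matrix.add_apply, Matrix.sub_apply, Matrix.smul_apply,
    Matrix.of_apply, smul_eq_mul, Nat.add_zero]
  ring_nf

theorem sHat_eq (a b : ℝ) (s : ℕ → Mat q) :
    sHat a b s = leftWeighted a (rightWeighted b s) := by
  funext j
  simp only [sHat, leftWeighted, rightWeighted]
  module

theorem P2_eq (a b : ℝ) (s : ℕ → Mat q) : P2 a b s = Gamma2 a (rightWeighted b s) := by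
  funext n z
  cases n with
  | zero => rfl
  | succ j => rw [P2, Y2, sHat_eq, H2_eq, Gamma2, YTilde2_eq, Y1]

theorem u2_add_smul (a b : ℝ) (s : ℕ → Mat q) (z : ℂ) (j : ℕ) :
    u2 a b s j + z • (v q j * s 0) =
      uTilde2 a (rightWeighted b s) j + (z - a) • (v q j * s 0) := by
  rw [v_mul, u2, sHat_eq]
  ext ⟨⟨i, hi⟩, l⟩ k
  cases i
  · simp only [blockCol, uTilde2, rightWeighted, Matrix.add_apply, Matrix.sub_apply,
      Matrix.neg_apply, Matrix.smul_apply, Matrix.of_apply, smul_eq_mul, ↓reduceIte]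
    ring
  · simp [uTilde2, blockCol, leftWeighted, neg_add_eq_sub]

theorem Q2_eq (a b : ℝ) (s : ℕ → Mat q) (n : ℕ) (z : ℂ) :
    Q2 a b s n z = -Theta2 a (rightWeighted b s) n z -
      (z - a) • (Gamma2 a (rightWeighted b s) n z * s 0) := by
  cases n with
  | zero =>
    simp only [Q2, Theta2, Gamma2, rightWeighted, one_mul, zero_add]
    module
  | succ j =>
    rw [Q2, Y2, sHat_eq, H2_eq, u2_add_smul, Theta2, Gamma2, YTilde2_eq, ← Y1, Matrix.mul_add,
      Matrix.mul_smul, Matrix.mul_assoc _ (v q (j + 1)), neg_add']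

theorem M_zero_eq (hs : IsPosDefSeq s 1) (a : ℝ) : M a s 0 = MSum a s 0 := by
  rw [M_eq hs, MSum_eq, kernelPoly, kernelPoly, rieszPoly, map_zero, sub_zero]

theorem m_eq (a : ℝ) (hs : IsPosDefSeq (rightWeighted b s) 1) (j : ℕ) :
    m a b s j = M a (rightWeighted b s) j := by
  cases j with
  | zero => exact (M_zero_eq hs a).symm
  | succ j => rfl

theorem lSum_eq (a b : ℝ) (h0 : (s 0)ᴴ = s 0) (j : ℕ) :
    lSum a b s j = LSum a (rightWeighted b s) j := by
  have hu : uTilde2 a (rightWeighted b s) j = u2 a b s j + (a : ℂ) • (v q j * s 0) := by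
    rw [u2_add_smul, sub_self, zero_smul, add_zero]
  rw [lSum, LSum, H2_eq, hu, Matrix.conjTranspose_add, Matrix.conjTranspose_smul,
    Matrix.conjTranspose_mul, h0, Complex.star_def, Complex.conj_ofReal]

theorem l_eq (a b : ℝ) (h0 : (s 0)ᴴ = s 0) (j : ℕ) : l a b s j = L a (rightWeighted b s) j := by
  cases j <;> simp only [l, L, lSum_eq a b h0]

end ExtremalSolutions

section Chain

variable {a : ℝ} {s : ℕ → Mat q} {y : ℂ} {k N : ℕ}

/-- The sequence `f 0, g 0, f 1, g 1, …`. -/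
def interleave {α : Type*} (f g : ℕ → α) (k : ℕ) : α := if Even k then f (k / 2) else g (k / 2)

theorem interleave_two_mul {α : Type*} (f g : ℕ → α) (n : ℕ) :
    interleave f g (2 * n) = f n := by
  rw [interleave, if_pos (even_two_mul n), Nat.mul_div_cancel_left n two_pos]

theorem interleave_two_mul_add_one {α : Type*} (f g : ℕ → α) (n : ℕ) :
    interleave f g (2 * n + 1) = g n := by
  rw [interleave, if_neg (Nat.not_even_bit1 n), Nat.mul_add_div two_pos,
    Nat.div_eq_of_lt one_lt_two, Nat.add_zero]

/-- The polynomials `f 0, g 0 √(t - a), f 1, g 1 √(t - a), …` in `√(t - a)`. -/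
def alternating (f g : ℕ → (Mat q)[X]) : ℕ → SqrtPoly q :=
  interleave (fun n => (f n, 0)) fun n => (0, g n)

/-- The polynomial in `t` equal to `e` or to `√(t - a) e`, if `e` is an even, respectively odd,
polynomial in `√(t - a)`. -/
def sqrtFold (a : ℝ) : SqrtPoly q →ₗ[Mat q] (Mat q)[X] :=
  LinearMap.id.coprod (mulXSub (a : ℂ))

theorem sqrtFold_alternating_two_mul (a : ℝ) (f g : ℕ → (Mat q)[X]) (n : ℕ) :
    sqrtFold a (alternating f g (2 * n)) = f n := by
  rw [alternating, interleave_two_mul]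
  simp [sqrtFold]

theorem sqrtFold_alternating_two_mul_add_one (a : ℝ) (f g : ℕ → (Mat q)[X]) (n : ℕ) :
    sqrtFold a (alternating f g (2 * n + 1)) = mulXSub (a : ℂ) (g n) := by
  rw [alternating, interleave_two_mul_add_one]
  simp [sqrtFold]

theorem isUnit_evalScalar_sqrtFold (hy : y ≠ 0) {f g : ℕ → (Mat q)[X]}
    (h : IsUnit (sqrtEval a y (alternating f g k))) :
    IsUnit (evalScalar (a + y ^ 2 : ℂ) (sqrtFold a (alternating f g k))) := by
  obtain ⟨n, rfl | rfl⟩ := k.even_or_odd'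
  · rw [sqrtFold_alternating_two_mul]
    simpa [alternating, interleave_two_mul, sqrtEval] using h
  · rw [sqrtFold_alternating_two_mul_add_one, evalScalar_mulXSub, add_sub_cancel_left, pow_two,
      mul_smul]
    refine (?_ : IsUnit _).smul (Units.mk0 y hy)
    simpa [alternating, interleave_two_mul_add_one, sqrtEval, pow_two] using h

theorem exists_remainder_sqrtFold_eq_smul (hy : y ≠ 0) (f g : ℕ → (Mat q)[X]) (k : ℕ) :
    ∃ u : ℂˣ, ∀ W, sqrtRemainder a s y W (alternating f g k) =
      u • remainder s (a + y ^ 2) W (sqrtFold a (alternating f g k)) := by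
  obtain ⟨n, rfl | rfl⟩ := k.even_or_odd'
  · refine ⟨Units.mk0 y hy, fun W => ?_⟩
    rw [sqrtFold_alternating_two_mul]
    simp [alternating, interleave_two_mul, sqrtRemainder, Units.smul_def]
  · refine ⟨1, fun W => ?_⟩
    rw [sqrtFold_alternating_two_mul_add_one, one_smul]
    simp [alternating, interleave_two_mul_add_one, sqrtRemainder]

/-- The monic orthogonal polynomials in `√(t - a)`. -/
def sqrtMonicOrth (a : ℝ) (s : ℕ → Mat q) : ℕ → SqrtPoly q :=
  alternating (monicOrth s) (monicOrth (leftWeighted a s))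

/-- The orthogonal polynomials in `√(t - a)` which satisfy the three-term recurrence with
coefficients `-(t - a) 𝐌_j` and `𝐋_j`. -/
def sqrtNormOrth (a : ℝ) (s : ℕ → Mat q) : ℕ → SqrtPoly q :=
  alternating (normOrth a s) fun j => -kernelPoly a s (j + 1)

theorem isSqrtOrth_sqrtMonicOrth (hs : IsStieltjesPosDef a s N) :
    IsSqrtOrth a s N (sqrtMonicOrth a s N) := by
  have hY : ∀ (c : ℕ → Mat q) (n : ℕ) (Y : Mat q), Y • monicOrth c n = 0 → Y = 0 :=
    fun c n Y h => by
      simpa only [coeff_smul, coeff_monicOrth, smul_eq_mul, mul_one, coeff_zero] using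
        congrArg (coeff · n) h
  rw [sqrtMonicOrth, alternating]
  obtain ⟨n, rfl | rfl⟩ := N.even_or_odd'
  · rw [interleave_two_mul]
    exact isSqrtOrth_left (monicOrth_mem_degreeLT s n)
      (fun k hk => moment_monicOrth (hs.isPosDefSeq (by omega)) hs.herm hk) (hY s n)
  · rw [interleave_two_mul_add_one]
    exact isSqrtOrth_right (monicOrth_mem_degreeLT _ n)
      (fun k hk => moment_monicOrth (hs.isPosDefSeq_leftWeighted (by omega))
        hs.hermBelow_leftWeighted hk) (hY _ n)

theorem isSqrtOrth_sqrtNormOrth (hs : IsStieltjesPosDef a s N) :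
    IsSqrtOrth a s N (sqrtNormOrth a s N) := by
  rw [sqrtNormOrth, alternating]
  obtain ⟨n, rfl | rfl⟩ := N.even_or_odd'
  · rw [interleave_two_mul]
    refine isSqrtOrth_left (normOrth_mem_degreeLT a s n) (fun k hk => moment_normOrth
      (hs.isPosDefSeq (by omega)) (hs.isPosDefSeq_leftWeighted (by omega)) hk) fun Y h => ?_
    simpa only [map_smul, evalScalar_normOrth, smul_eq_mul, mul_one, map_zero] using
      congrArg (evalScalar (a : ℂ)) h
  · have hs' : IsPosDefSeq s (n + 1) := hs.isPosDefSeq (by omega)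
    rw [interleave_two_mul_add_one]
    refine isSqrtOrth_right (Submodule.neg_mem _ (kernelPoly_mem_degreeLT a s (n + 1)))
      (fun k hk => by rw [map_neg, moment_leftWeighted_kernelPoly hs' hk, neg_zero]) fun Y h => ?_
    rw [smul_neg, neg_eq_zero] at h
    simpa only [map_smul, moment_kernelPoly hs' n.succ_pos, pow_zero, one_smul, smul_eq_mul,
      mul_one, map_zero] using congrArg (moment s 0) h

/-- The value at `w` of the transform `∫ σ(dt) (t - w)⁻¹` of the representing measure `σ` for which
the remainder of `B` vanishes. -/
def cauchyValue (s : ℕ → Mat q) (w : ℂ) (B : (Mat q)[X]) : Mat q :=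
  -((evalScalar w B)⁻¹ * remainder s w 0 B)

theorem remainder_cauchyValue {w : ℂ} {B : (Mat q)[X]} (hB : IsUnit (evalScalar w B)) :
    remainder s w (cauchyValue s w B) B = 0 := by
  rw [remainder_eq_add, cauchyValue, mul_neg,
    Matrix.mul_nonsing_inv_cancel_left _ _ ((Matrix.isUnit_iff_isUnit_det _).1 hB),
    neg_add_cancel]

/-- The monic polynomials whose transforms `cauchyValue` are the extremal solutions. -/
def extremalPoly (a : ℝ) (s : ℕ → Mat q) (N : ℕ) : (Mat q)[X] := sqrtFold a (sqrtMonicOrth a s N)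

/-- The polynomials `p₀, -(t - a) k₁, p₁, -(t - a) k₂, …`, with `pⱼ` the orthogonal polynomials
of value `1` at `a` and `kⱼ` the reproducing kernels at `a`. -/
def chainPoly (a : ℝ) (s : ℕ → Mat q) (N : ℕ) : (Mat q)[X] := sqrtFold a (sqrtNormOrth a s N)

section

variable (hs : IsStieltjesPosDef a s N) (hy : NotMemSqrtRange a s N y) (hy0 : y ≠ 0)
include hs hy hy0

theorem isUnit_evalScalar_extremalPoly :
    IsUnit (evalScalar (a + y ^ 2 : ℂ) (extremalPoly a s N)) :=
  isUnit_evalScalar_sqrtFold hy0 ((isSqrtOrth_sqrtMonicOrth hs).isUnit_sqrtEval hy)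

theorem remainder_chainPoly_eq_zero :
    remainder s (a + y ^ 2) (cauchyValue s (a + y ^ 2) (extremalPoly a s N)) (chainPoly a s N) =
      0 := by
  obtain ⟨Z, hZ⟩ :=
    (isSqrtOrth_sqrtMonicOrth hs).exists_eq_smul (isSqrtOrth_sqrtNormOrth hs) hy
  rw [chainPoly, hZ, map_smul, map_smul, ← extremalPoly,
    remainder_cauchyValue (isUnit_evalScalar_extremalPoly hs hy hy0), smul_zero]

theorem isUnit_remainder_chainPoly (hk : k < N) :
    IsUnit (remainder s (a + y ^ 2) (cauchyValue s (a + y ^ 2) (extremalPoly a s N))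
      (chainPoly a s k)) := by
  obtain ⟨u, hu⟩ := exists_remainder_sqrtFold_eq_smul (a := a) (s := s) hy0 (monicOrth s)
    (monicOrth (leftWeighted a s)) N
  obtain ⟨u', hu'⟩ := exists_remainder_sqrtFold_eq_smul (a := a) (s := s) hy0 (normOrth a s)
    (fun j => -kernelPoly a s (j + 1)) k
  have h0 := remainder_cauchyValue (s := s) (isUnit_evalScalar_extremalPoly hs hy hy0)
  have hunit := (isSqrtOrth_sqrtMonicOrth hs).isUnit_sqrtRemainder hs
    (isSqrtOrth_sqrtNormOrth (hs.mono hk.le)) hk hy ((hu _).trans (by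
      rw [← sqrtMonicOrth, ← extremalPoly, h0, smul_zero]))
  rwa [sqrtNormOrth, hu', isUnit_smul_iff] at hunit

end

end Chain

section ContinuedFraction

theorem contFrac_cons (c : Mat q) {t : List (Mat q)} (ht : t ≠ []) :
    contFrac (c :: t) = c + (contFrac t)⁻¹ := by
  cases t with
  | nil => exact absurd rfl ht
  | cons => rfl

theorem contFracDefined_cons (c : Mat q) {t : List (Mat q)} (ht : t ≠ []) :
    ContFracDefined (c :: t) ↔ IsUnit (contFrac t) ∧ ContFracDefined t := by
  cases t with
  | nil => exact absurd rfl ht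
  | cons => rfl

theorem contFracDefined_cons_congr {c : Mat q} (d : Mat q) {t : List (Mat q)}
    (h : ContFracDefined (c :: t)) : ContFracDefined (d :: t) := by
  cases t with
  | nil => trivial
  | cons => exact h

theorem contFrac_cons_eq_add (c : Mat q) (t : List (Mat q)) :
    contFrac (c :: t) = c + contFrac (0 :: t) := by
  cases t with
  | nil => exact (add_zero c).symm
  | cons => rw [contFrac, contFrac, zero_add]

theorem map_range_succ {α : Type*} (c : ℕ → α) (N : ℕ) :
    (List.range (N + 1)).map c = c 0 :: (List.range N).map fun k => c (k + 1) := by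
  simp [List.range_succ_eq_map]

theorem contFrac_of_recurrence {x c : ℕ → Mat q} (N : ℕ)
    (hrec : ∀ k ≤ N, x (k + 2) = x (k + 1) * c k + x k) (hunit : ∀ k ≤ N, IsUnit (x (k + 1)))
    (hzero : x (N + 2) = 0) :
    ContFracDefined ((List.range (N + 1)).map c) ∧
      contFrac ((List.range (N + 1)).map c) = -((x 1)⁻¹ * x 0) := by
  have hdet := (Matrix.isUnit_iff_isUnit_det _).1 (hunit 0 N.zero_le)
  have hhead : c 0 = (x 1)⁻¹ * x 2 - (x 1)⁻¹ * x 0 := by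
    rw [hrec 0 N.zero_le, mul_add, Matrix.nonsing_inv_mul_cancel_left _ _ hdet,
      add_sub_cancel_right]
  induction N generalizing x c with
  | zero => exact ⟨trivial, by simpa [contFrac, hzero] using hhead⟩
  | succ N ih =>
    have hunit' := hunit 1 (by omega)
    have hdet' := (Matrix.isUnit_iff_isUnit_det _).1 hunit'
    obtain ⟨htail, hval⟩ := ih (x := fun k => x (k + 1)) (c := fun k => c (k + 1))
      (fun k hk => hrec (k + 1) (by omega)) (fun k hk => hunit (k + 1) (by omega)) hzero hdet'
      (by
        rw [hrec 1 (by omega), mul_add, Matrix.nonsing_inv_mul_cancel_left _ _ hdet',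
          add_sub_cancel_right])
    have hinv : (-((x 2)⁻¹ * x 1))⁻¹ = -((x 1)⁻¹ * x 2) := Matrix.inv_eq_right_inv (by
      rw [neg_mul_neg, mul_assoc, Matrix.mul_nonsing_inv_cancel_left _ _ hdet,
        Matrix.nonsing_inv_mul _ hdet'])
    have hne : (List.range (N + 1)).map (fun k => c (k + 1)) ≠ [] := by simp
    rw [map_range_succ, contFracDefined_cons _ hne, contFrac_cons _ hne]
    refine ⟨⟨?_, htail⟩, ?_⟩
    · rw [hval]
      exact (((Matrix.isUnit_nonsing_inv_iff).2 hunit').mul (hunit 0 (by omega))).neg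
    · rw [hval, hinv, hhead]
      abel

/-- The list `u c₀, u⁻¹ c₁, u c₂, u⁻¹ c₃, …`: the equivalence transformation of the continued
fraction of `c₀, c₁, c₂, …` which multiplies its value by `u`. -/
def altSMul (u : ℂˣ) : List (Mat q) → List (Mat q)
  | [] => []
  | c :: t => u • c :: altSMul u⁻¹ t

theorem altSMul_flatMap_append {ι : Type*} (u : ℂˣ) (f g : ι → Mat q) (l : List ι)
    (t : List (Mat q)) :
    altSMul u ((l.flatMap fun i => [f i, g i]) ++ t) =
      (l.flatMap fun i => [u • f i, u⁻¹ • g i]) ++ altSMul u t := by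
  induction l with
  | nil => rfl
  | cons i l ih => simp [altSMul, ih]

theorem contFrac_altSMul {t : List (Mat q)} (ht : ContFracDefined t) (u : ℂˣ) :
    ContFracDefined (altSMul u t) ∧ contFrac (altSMul u t) = u • contFrac t := by
  induction t generalizing u with
  | nil => exact ⟨trivial, (smul_zero u).symm⟩
  | cons c t ih =>
    cases t with
    | nil => exact ⟨trivial, rfl⟩
    | cons d t =>
      obtain ⟨hdef, hval⟩ := ih ht.2 u⁻¹
      have hne : altSMul u⁻¹ (d :: t) ≠ [] := List.cons_ne_nil _ _
      rw [altSMul, contFracDefined_cons _ hne, contFrac_cons _ hne, hval]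
      refine ⟨⟨ht.1.smul _, hdef⟩, ?_⟩
      rw [Matrix.inv_smul' _ _ ((Matrix.isUnit_iff_isUnit_det _).1 ht.1), inv_inv, contFrac,
        smul_add]

theorem flatMap_pair_range {α : Type*} (f g : ℕ → α) (n : ℕ) :
    ((List.range n).flatMap fun j => [f j, g j]) = (List.range (2 * n)).map (interleave f g) := by
  induction n with
  | zero => rfl
  | succ n ih =>
    rw [Nat.mul_succ, List.range_succ, List.range_succ, List.range_succ]
    simp [ih, interleave_two_mul, interleave_two_mul_add_one]

end ContinuedFraction

section StieltjesFraction

variable {a b : ℝ} {s : ℕ → Mat q} {w y z : ℂ} {W : Mat q} {N n : ℕ}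

theorem chainPoly_two_mul (a : ℝ) (s : ℕ → Mat q) (n : ℕ) :
    chainPoly a s (2 * n) = normOrth a s n :=
  sqrtFold_alternating_two_mul _ _ _ _

theorem chainPoly_two_mul_add_one (a : ℝ) (s : ℕ → Mat q) (n : ℕ) :
    chainPoly a s (2 * n + 1) = -mulXSub (a : ℂ) (kernelPoly a s (n + 1)) := by
  rw [chainPoly, sqrtNormOrth, sqrtFold_alternating_two_mul_add_one, map_neg]

/-- The coefficients `-(z - a) 𝐌₀, 𝐋₀, -(z - a) 𝐌₁, 𝐋₁, …` of the Stieltjes continued fraction. -/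
def stieltjesCoeff (a : ℝ) (s : ℕ → Mat q) (z : ℂ) : ℕ → Mat q :=
  interleave (fun j => -(z - a) • M a s j) (L a s)

theorem conjTranspose_stieltjesCoeff (hs : IsStieltjesPosDef a s (N + 1)) (z : ℂ) :
    (stieltjesCoeff a s z N)ᴴ = stieltjesCoeff a s (star z) N := by
  obtain ⟨j, rfl | rfl⟩ := N.even_or_odd'
  · simp only [stieltjesCoeff, interleave_two_mul, Matrix.conjTranspose_smul,
      conjTranspose_M (j := j) (hs.isPosDefSeq (by omega)), star_neg, star_sub, Complex.star_def,
      Complex.conj_ofReal]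
  · simp only [stieltjesCoeff, interleave_two_mul_add_one,
      conjTranspose_L (j := j) (hs.isPosDefSeq_leftWeighted (by omega))]

theorem remainder_chainPoly_zero : remainder s w W (chainPoly a s 0) = W := by
  rw [← Nat.mul_zero 2, chainPoly_two_mul, normOrth_zero, remainder_one]

theorem remainder_chainPoly_one (hs : IsStieltjesPosDef a s 1) :
    remainder s w W (chainPoly a s 1) =
      stieltjesCoeff a s w 0 * remainder s w W (chainPoly a s 0) - 1 := by
  have hs' : IsPosDefSeq s 1 := hs.isPosDefSeq (by omega)
  have hk : kernelPoly a s 1 = M a s 0 • 1 := by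
    rw [← normOrth_zero a s, kernelPoly_succ hs' (hs.isPosDefSeq_leftWeighted (by omega)),
      show kernelPoly a s 0 = 0 from rfl, zero_add]
  have hM : M a s 0 • moment s 0 1 = 1 := by
    rw [← map_smul, ← hk, moment_kernelPoly hs' zero_lt_one, pow_zero, one_smul]
  rw [remainder_chainPoly_zero, ← Nat.zero_add 1, ← Nat.mul_zero 2, chainPoly_two_mul_add_one, hk,
    stieltjesCoeff, interleave_two_mul, map_neg, remainder_mulXSub, map_smul, map_smul,
    remainder_one, hM]
  simp only [smul_eq_mul, neg_smul, neg_mul, smul_mul_assoc]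
  abel

theorem remainder_chainPoly_add_two (hs : IsStieltjesPosDef a s (N + 2)) :
    remainder s w W (chainPoly a s (N + 2)) =
      stieltjesCoeff a s w (N + 1) * remainder s w W (chainPoly a s (N + 1)) +
        remainder s w W (chainPoly a s N) := by
  obtain ⟨n, rfl | rfl⟩ := N.even_or_odd'
  · rw [← Nat.mul_succ, chainPoly_two_mul, chainPoly_two_mul, chainPoly_two_mul_add_one,
      normOrth_succ (hs.isPosDefSeq (by omega)) (hs.isPosDefSeq_leftWeighted (by omega)),
      stieltjesCoeff, interleave_two_mul_add_one, map_sub, map_smul, map_neg, smul_eq_mul,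
      mul_neg]
    abel
  · have hs' : IsPosDefSeq s (n + 2) := hs.isPosDefSeq (by omega)
    have hl : IsPosDefSeq (leftWeighted a s) (n + 1) := hs.isPosDefSeq_leftWeighted (by omega)
    have hm : moment s 0 (normOrth a s (n + 1)) = 0 :=
      moment_normOrth (hs'.mono (by omega)) hl n.succ_pos
    rw [show 2 * n + 1 + 2 = 2 * (n + 1) + 1 by omega, show 2 * n + 1 + 1 = 2 * (n + 1) by omega,
      chainPoly_two_mul, chainPoly_two_mul_add_one, chainPoly_two_mul_add_one,
      kernelPoly_succ hs' hl, stieltjesCoeff, interleave_two_mul, map_add, map_smul, map_neg,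
      map_neg, map_add, map_smul, remainder_mulXSub _ _ _ _ (normOrth a s (n + 1)), hm]
    simp only [smul_eq_mul, neg_smul, neg_mul, smul_mul_assoc, mul_smul_comm, add_zero]
    abel

/-- The Stieltjes continued fraction `0 + I/(c₀ + I/(c₁ + ⋯ + I/c_{N-1}))` with the coefficients
`stieltjesCoeff`. -/
def stieltjesTerms (a : ℝ) (s : ℕ → Mat q) (z : ℂ) (N : ℕ) : List (Mat q) :=
  0 :: (List.range N).map (stieltjesCoeff a s z)

theorem contFrac_stieltjesTerms (hs : IsStieltjesPosDef a s (N + 1))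
    (hy : NotMemSqrtRange a s (N + 1) y) (hy0 : y ≠ 0) (hz : star z = a + y ^ 2) :
    ContFracDefined (stieltjesTerms a s z (N + 1)) ∧
      contFrac (stieltjesTerms a s z (N + 1)) =
        (cauchyValue s (star z) (extremalPoly a s (N + 1)))ᴴ := by
  set W := cauchyValue s (star z) (extremalPoly a s (N + 1)) with hW
  have hunit : ∀ k ≤ N, IsUnit (remainder s (star z) W (chainPoly a s k)) := fun k hk => by
    rw [hW, hz]
    exact isUnit_remainder_chainPoly hs hy hy0 (by omega)
  have hzero : remainder s (star z) W (chainPoly a s (N + 1)) = 0 := by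
    rw [hW, hz]
    exact remainder_chainPoly_eq_zero hs hy hy0
  have hcoeff : ∀ k ≤ N, (stieltjesCoeff a s (star z) k)ᴴ = stieltjesCoeff a s z k :=
    fun k hk => by rw [conjTranspose_stieltjesCoeff (hs.mono (by omega)), star_star]
  let x : ℕ → Mat q := fun k =>
    Nat.casesOn k (-1) fun k => (remainder s (star z) W (chainPoly a s k))ᴴ
  have hrec : ∀ k ≤ N, x (k + 2) = x (k + 1) * stieltjesCoeff a s z k + x k
    | 0, hk => by
      change (remainder s (star z) W (chainPoly a s 1))ᴴ =
        (remainder s (star z) W (chainPoly a s 0))ᴴ * stieltjesCoeff a s z 0 + -1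
      rw [remainder_chainPoly_one (hs.mono (by omega)), Matrix.conjTranspose_sub,
        Matrix.conjTranspose_mul, Matrix.conjTranspose_one, hcoeff 0 hk, sub_eq_add_neg]
    | k + 1, hk => by
      simp only [x, remainder_chainPoly_add_two (hs.mono (show k + 2 ≤ N + 1 by omega)),
        Matrix.conjTranspose_add, Matrix.conjTranspose_mul, hcoeff (k + 1) hk]
  obtain ⟨hdef, hval⟩ := contFrac_of_recurrence N hrec (fun k hk => (hunit k hk).star)
    (by simp only [x, hzero, Matrix.conjTranspose_zero])
  have hx : x 1 = Wᴴ := congrArg star (remainder_chainPoly_zero (a := a) (s := s))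
  have hWu : IsUnit Wᴴ := hx ▸ (hunit 0 N.zero_le).star
  have hne : (List.range (N + 1)).map (stieltjesCoeff a s z) ≠ [] := by simp
  rw [hx, show x 0 = -1 from rfl, mul_neg_one, neg_neg] at hval
  rw [stieltjesTerms, contFracDefined_cons _ hne, contFrac_cons _ hne, hval, zero_add,
    Matrix.nonsing_inv_nonsing_inv _ ((Matrix.isUnit_iff_isUnit_det _).1 hWu)]
  exact ⟨⟨Matrix.isUnit_nonsing_inv_iff.2 hWu, hdef⟩, rfl⟩

theorem termsKreinEven_eq (a : ℝ) (s : ℕ → Mat q) (n : ℕ) (z : ℂ) :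
    termsKreinEven a s n z = stieltjesTerms a s z (2 * n + 1) := by
  rw [termsKreinEven, MLList, flatMap_pair_range, stieltjesTerms, List.range_succ, List.map_append,
    List.map_singleton, stieltjesCoeff, interleave_two_mul]

theorem termsFriedrichsOdd_eq_cons (a : ℝ) (s : ℕ → Mat q) (n : ℕ) (z : ℂ) :
    termsFriedrichsOdd a s n z = 0 :: MLList a s z (n + 1) := by
  simp [termsFriedrichsOdd, MLList, List.range_succ]

theorem termsFriedrichsOdd_eq (a : ℝ) (s : ℕ → Mat q) (n : ℕ) (z : ℂ) :
    termsFriedrichsOdd a s n z = stieltjesTerms a s z (2 * n + 2) := by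
  rw [termsFriedrichsOdd_eq_cons, MLList, flatMap_pair_range]
  rfl

theorem friedrichsOdd_eq_cauchyValue (a : ℝ) (s : ℕ → Mat q) (n : ℕ) (z : ℂ) :
    friedrichsOdd s n z = (cauchyValue s (star z) (extremalPoly a s (2 * n + 2)))ᴴ := by
  rw [extremalPoly, sqrtMonicOrth, show 2 * n + 2 = 2 * (n + 1) from rfl,
    sqrtFold_alternating_two_mul, friedrichsOdd, denFriedrichsOdd, cauchyValue, P1_eq, Q1_eq,
    Matrix.conjTranspose_neg, Matrix.conjTranspose_mul, Matrix.conjTranspose_nonsing_inv]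

theorem denFriedrichsOdd_eq (a : ℝ) (s : ℕ → Mat q) (n : ℕ) (z : ℂ) :
    denFriedrichsOdd s n z = (evalScalar (star z) (extremalPoly a s (2 * n + 2)))ᴴ := by
  rw [extremalPoly, sqrtMonicOrth, show 2 * n + 2 = 2 * (n + 1) from rfl,
    sqrtFold_alternating_two_mul, denFriedrichsOdd, P1_eq]

theorem denKreinEven_eq (a : ℝ) (s : ℕ → Mat q) (n : ℕ) (z : ℂ) :
    denKreinEven a s n z = (evalScalar (star z) (extremalPoly a s (2 * n + 1)))ᴴ := by
  rw [extremalPoly, sqrtMonicOrth, sqrtFold_alternating_two_mul_add_one, denKreinEven, Gamma2_eq,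
    P1_eq, evalScalar_mulXSub, Matrix.conjTranspose_smul, star_sub, star_star, Complex.star_def,
    Complex.conj_ofReal]

theorem kreinEven_eq_cauchyValue (a : ℝ) (s : ℕ → Mat q) (n : ℕ) (z : ℂ) :
    kreinEven a s n z = (cauchyValue s (star z) (extremalPoly a s (2 * n + 1)))ᴴ := by
  rw [cauchyValue, Matrix.conjTranspose_neg, Matrix.conjTranspose_mul,
    Matrix.conjTranspose_nonsing_inv, ← denKreinEven_eq, extremalPoly, sqrtMonicOrth,
    sqrtFold_alternating_two_mul_add_one, kreinEven, Theta2_eq, Matrix.conjTranspose_neg, neg_mul]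

theorem exists_star_eq_add_sq (hab : a ≤ b) (hz : z ∉ Complex.ofReal '' Set.Icc a b) :
    ∃ y : ℂ, y ≠ 0 ∧ star z = a + y ^ 2 ∧ (a + y ^ 2 : ℂ) ∉ Complex.ofReal '' Set.Icc a b := by
  obtain ⟨y, hy⟩ := IsAlgClosed.exists_pow_nat_eq (star z - a) two_pos
  have hz' : star z = a + y ^ 2 := by rw [hy, add_sub_cancel]
  refine ⟨y, fun h => hz ⟨a, ⟨le_rfl, hab⟩, ?_⟩, hz', ?_⟩
  · rw [← star_star z, hz', h]
    simp
  · rintro ⟨x, hx, h⟩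
    refine hz ⟨x, hx, ?_⟩
    rw [← star_star z, hz', ← h, Complex.star_def, Complex.conj_ofReal]

theorem IsStieltjesPosDef.kreinEven (hab : a ≤ b) (hs : IsStieltjesPosDef a s (2 * n + 1))
    (hb : PosSemidefBelow (rightWeighted b (leftWeighted a s)) n)
    (hz : z ∉ Complex.ofReal '' Set.Icc a b) :
    IsUnit (denKreinEven a s n z) ∧ ContFracDefined (termsKreinEven a s n z) ∧
      kreinEven a s n z = contFrac (termsKreinEven a s n z) := by
  obtain ⟨y, hy0, hzy, hy⟩ := exists_star_eq_add_sq hab hz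
  have hrange := notMemSqrtRange_odd hab hs hb hy
  obtain ⟨hdef, hval⟩ := contFrac_stieltjesTerms hs hrange hy0 hzy
  rw [denKreinEven_eq, termsKreinEven_eq, kreinEven_eq_cauchyValue, hzy]
  exact ⟨(isUnit_evalScalar_extremalPoly hs hrange hy0).star, hdef, hzy ▸ hval.symm⟩

theorem IsStieltjesPosDef.friedrichsOdd (hab : a ≤ b) (hs : IsStieltjesPosDef a s (2 * n + 2))
    (hb : PosSemidefBelow (rightWeighted b s) (n + 1))
    (hz : z ∉ Complex.ofReal '' Set.Icc a b) :
    IsUnit (denFriedrichsOdd s n z) ∧ ContFracDefined (termsFriedrichsOdd a s n z) ∧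
      friedrichsOdd s n z = contFrac (termsFriedrichsOdd a s n z) := by
  obtain ⟨y, hy0, hzy, hy⟩ := exists_star_eq_add_sq hab hz
  have hrange := notMemSqrtRange_even (n := n + 1) hab hs hb hy
  obtain ⟨hdef, hval⟩ := contFrac_stieltjesTerms hs hrange hy0 hzy
  rw [denFriedrichsOdd_eq a, termsFriedrichsOdd_eq, friedrichsOdd_eq_cauchyValue a, hzy]
  exact ⟨(isUnit_evalScalar_extremalPoly hs hrange hy0).star, hdef, hzy ▸ hval.symm⟩

end StieltjesFraction

section Hausdorff

variable {a b : ℝ} {s : ℕ → Mat q} {z : ℂ} {N n : ℕ}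

theorem posDefBelow_zero (s : ℕ → Mat q) : PosDefBelow s 0 :=
  fun _ hp h0 => absurd (degree_eq_bot.1 (Nat.WithBot.lt_zero_iff.1 (mem_degreeLT.1 hp))) h0

theorem PosDefBelow.rightWeighted_rightWeighted (hs : PosDefBelow s (n + 1)) (b : ℝ) :
    PosDefBelow (rightWeighted b (rightWeighted b s)) n := by
  intro p hp h0
  rw [form_rightWeighted, form_rightWeighted, neg_neg, form_mulXSub_comm]
  exact hs _ ((mulXSub_mem_degreeLT_iff _).2 hp) ((map_ne_zero_iff _ (mulXSub_injective _)).2 h0)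

theorem IsPosDefSeq.rightWeighted_rightWeighted (hs : IsPosDefSeq s (n + 1)) (b : ℝ) :
    IsPosDefSeq (rightWeighted b (rightWeighted b s)) n where
  herm := by
    cases n with
    | zero => exact fun k hk => absurd hk k.not_lt_zero
    | succ n => exact (HermBelow.rightWeighted (N := 2 * n + 2) hs.herm b).rightWeighted b
  pos := hs.pos.rightWeighted_rightWeighted b

theorem posDefBelow_of_leftWeighted_of_rightWeighted (hab : a < b)
    (hl : PosDefBelow (leftWeighted a s) n) (hr : PosDefBelow (rightWeighted b s) n) :
    PosDefBelow s n := by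
  intro p hp h0
  have hsum := add_pos (hl p hp h0) (hr p hp h0)
  rw [← Matrix.trace_add, form_leftWeighted_add_form_rightWeighted, Matrix.trace_smul,
    smul_eq_mul] at hsum
  exact pos_of_mul_pos_right hsum (Complex.zero_le_real.2 (sub_nonneg.2 hab.le))

theorem hermBelow_of_leftWeighted_of_rightWeighted (hab : a < b)
    (hl : HermBelow (leftWeighted a s) (N + 1)) (hr : HermBelow (rightWeighted b s) (N + 1)) :
    HermBelow s (N + 2) := by
  have hba : (b : ℂ) - a ≠ 0 := sub_ne_zero.2 (by exact_mod_cast hab.ne')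
  have hs : HermBelow s (N + 1) := fun k hk => by
    have hsum : ((b : ℂ) - a) • s k = leftWeighted a s k + rightWeighted b s k := by
      simp only [leftWeighted, rightWeighted]
      module
    have hstar := congrArg Matrix.conjTranspose hsum
    rw [Matrix.conjTranspose_add, hl k hk, hr k hk, ← hsum, Matrix.conjTranspose_smul, star_sub,
      Complex.star_def, Complex.conj_ofReal, Complex.conj_ofReal] at hstar
    exact smul_right_injective _ hba hstar
  intro k hk
  cases k with
  | zero => exact hs 0 N.succ_pos
  | succ k =>
    have hsum : s (k + 1) = leftWeighted a s k + (a : ℂ) • s k := by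
      rw [leftWeighted, sub_add_cancel]
    rw [hsum, Matrix.conjTranspose_add, Matrix.conjTranspose_smul, hl k (by omega),
      hs k (by omega), Complex.star_def, Complex.conj_ofReal]

section Even

variable (h : HausdorffPosDefEven a b s n)
include h

theorem HausdorffPosDefEven.isPosDefSeq : IsPosDefSeq s (n + 1) := posDef_hankel_iff.1 h.1

theorem HausdorffPosDefEven.posDefBelow_leftWeighted_rightWeighted :
    PosDefBelow (leftWeighted a (rightWeighted b s)) n := by
  cases n with
  | zero => exact posDefBelow_zero _
  | succ n =>
    have h2 := h.2 n rfl
    rw [H2_eq, K2_eq] at h2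
    exact (posDef_hankel_iff.1 h2).pos

theorem HausdorffPosDefEven.isStieltjesPosDef (hab : a < b) :
    IsStieltjesPosDef a s (2 * n + 1) where
  herm := h.isPosDefSeq.herm.mono (by omega)
  pos := h.isPosDefSeq.pos.mono (by omega)
  posLeft := by
    refine PosDefBelow.mono (n := n) (posDefBelow_of_leftWeighted_of_rightWeighted hab
      (h.isPosDefSeq.pos.leftWeighted_leftWeighted a) ?_) (by omega)
    rw [← leftWeighted_rightWeighted]
    exact h.posDefBelow_leftWeighted_rightWeighted

theorem HausdorffPosDefEven.krein (hab : a < b) (hz : z ∉ Complex.ofReal '' Set.Icc a b) :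
    IsUnit (denKreinEven a s n z) ∧ ContFracDefined (termsKreinEven a s n z) ∧
      kreinEven a s n z = contFrac (termsKreinEven a s n z) := by
  refine (h.isStieltjesPosDef hab).kreinEven hab.le ?_ hz
  rw [← leftWeighted_rightWeighted]
  exact h.posDefBelow_leftWeighted_rightWeighted.posSemidefBelow

end Even

theorem HausdorffPosDefEven.rightWeighted (h : HausdorffPosDefEven a b s (n + 1)) :
    HausdorffPosDefOdd a b (rightWeighted b s) n :=
  ⟨posDef_hankel_iff.2 (h.isPosDefSeq.rightWeighted_rightWeighted b), H2_eq a b s n ▸ h.2 n rfl⟩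

section Odd

variable (h : HausdorffPosDefOdd a b s n)
include h

theorem HausdorffPosDefOdd.isPosDefSeq_rightWeighted : IsPosDefSeq (rightWeighted b s) (n + 1) :=
  posDef_hankel_iff.1 h.1

theorem HausdorffPosDefOdd.isPosDefSeq_leftWeighted : IsPosDefSeq (leftWeighted a s) (n + 1) :=
  posDef_hankel_iff.1 (K2_eq a s n ▸ h.2)

theorem HausdorffPosDefOdd.isStieltjesPosDef (hab : a < b) :
    IsStieltjesPosDef a s (2 * n + 2) where
  herm := hermBelow_of_leftWeighted_of_rightWeighted hab
    (h.isPosDefSeq_leftWeighted.herm.mono (by omega))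
    (h.isPosDefSeq_rightWeighted.herm.mono (by omega))
  pos := PosDefBelow.mono (posDefBelow_of_leftWeighted_of_rightWeighted hab
    h.isPosDefSeq_leftWeighted.pos
    h.isPosDefSeq_rightWeighted.pos) (by omega)
  posLeft := h.isPosDefSeq_leftWeighted.pos.mono (by omega)

theorem HausdorffPosDefOdd.friedrichs (hab : a < b) (hz : z ∉ Complex.ofReal '' Set.Icc a b) :
    IsUnit (denFriedrichsOdd s n z) ∧ ContFracDefined (termsFriedrichsOdd a s n z) ∧
      friedrichsOdd s n z = contFrac (termsFriedrichsOdd a s n z) :=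
  (h.isStieltjesPosDef hab).friedrichsOdd hab.le
    h.isPosDefSeq_rightWeighted.pos.posSemidefBelow hz

theorem HausdorffPosDefOdd.rightWeighted : HausdorffPosDefEven a b (rightWeighted b s) n := by
  refine ⟨h.1, fun k hk => ?_⟩
  subst hk
  rw [H2_eq, K2_eq, leftWeighted_rightWeighted, leftWeighted_rightWeighted]
  exact posDef_hankel_iff.2 (h.isPosDefSeq_leftWeighted.rightWeighted_rightWeighted b)

end Odd

end Hausdorff

section EquivalenceTransformation

variable {a b : ℝ} {s : ℕ → Mat q} {z : ℂ} {n : ℕ} {β : ℂˣ}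

theorem contFrac_altSMul_cons (c : Mat q) {t : List (Mat q)} (ht : ContFracDefined (0 :: t))
    (u : ℂˣ) : ContFracDefined (altSMul u (c :: t)) ∧
      contFrac (altSMul u (c :: t)) = u • (c + contFrac (0 :: t)) := by
  rw [← contFrac_cons_eq_add]
  exact contFrac_altSMul (contFracDefined_cons_congr c ht) u

theorem mlList_append_altSMul (hs : IsPosDefSeq (rightWeighted b s) 1) (h0 : (s 0)ᴴ = s 0)
    (hβ : (β : ℂ) = b - z) (a : ℝ) (n : ℕ) (t : List (Mat q)) :
    mlList a b s z n ++ altSMul β t = altSMul β (MLList a (rightWeighted b s) z n ++ t) := by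
  rw [MLList, altSMul_flatMap_append, mlList]
  simp only [m_eq a hs, l_eq a b h0, Units.smul_def, Units.val_inv_eq_inv_val, hβ, smul_smul,
    mul_neg, mul_comm]

theorem termsFriedrichsEven_eq (hs : IsPosDefSeq (rightWeighted b s) 1) (h0 : (s 0)ᴴ = s 0)
    (hβ : (β : ℂ) = b - z) (a : ℝ) (n : ℕ) :
    termsFriedrichsEven a b s n z = altSMul β⁻¹ (s 0 :: MLList a (rightWeighted b s) z n) := by
  have h := mlList_append_altSMul hs h0 hβ a n []
  rw [altSMul, List.append_nil, List.append_nil] at h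
  rw [termsFriedrichsEven, h, altSMul, inv_inv, Units.smul_def, Units.val_inv_eq_inv_val, hβ]

theorem termsKreinOdd_eq (hs : IsPosDefSeq (rightWeighted b s) 1) (h0 : (s 0)ᴴ = s 0)
    (hβ : (β : ℂ) = b - z) (a : ℝ) (n : ℕ) :
    termsKreinOdd a b s n z = altSMul β⁻¹ (s 0 :: (MLList a (rightWeighted b s) z n ++
      [-(z - (a : ℂ)) • M a (rightWeighted b s) n])) := by
  rw [termsKreinOdd, altSMul, inv_inv, ← mlList_append_altSMul hs h0 hβ, altSMul, altSMul,
    m_eq a hs, Units.smul_def, Units.smul_def, Units.val_inv_eq_inv_val, hβ, smul_smul, mul_neg,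
    mul_comm (z - (a : ℂ))]

theorem denFriedrichsEven_succ (hβ : (β : ℂ) = b - z) :
    denFriedrichsEven b s (n + 1) z = β • denFriedrichsOdd (rightWeighted b s) n z := by
  rw [denFriedrichsEven, denFriedrichsOdd, Gamma1_eq, Units.smul_def, hβ]

theorem friedrichsEven_succ (hβ : (β : ℂ) = b - z) (h0 : (s 0)ᴴ = s 0)
    (h : IsUnit (denFriedrichsOdd (rightWeighted b s) n z)) :
    friedrichsEven b s (n + 1) z = β⁻¹ • (s 0 + friedrichsOdd (rightWeighted b s) n z) := by
  have hdet := (Matrix.isUnit_iff_isUnit_det _).1 h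
  rw [friedrichsEven, denFriedrichsEven_succ hβ, Matrix.inv_smul' _ _ hdet, mul_smul_comm,
    Theta1_eq, Matrix.conjTranspose_sub, Matrix.conjTranspose_mul, h0, friedrichsOdd,
    ← denFriedrichsOdd, sub_mul, Matrix.mul_nonsing_inv_cancel_right _ _ hdet, sub_eq_add_neg]

theorem denKreinOdd_eq (hβ : (β : ℂ) = b - z) :
    denKreinOdd a b s n z = β • denKreinEven a (rightWeighted b s) n z := by
  rw [denKreinOdd, denKreinEven, P2_eq, Units.smul_def, hβ, smul_smul, mul_comm]

theorem kreinOdd_eq (hβ : (β : ℂ) = b - z) (h0 : (s 0)ᴴ = s 0)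
    (h : IsUnit (denKreinEven a (rightWeighted b s) n z)) :
    kreinOdd a b s n z = β⁻¹ • (s 0 + kreinEven a (rightWeighted b s) n z) := by
  have hdet := (Matrix.isUnit_iff_isUnit_det _).1 h
  have hQ : (Q2 a b s n (star z))ᴴ = -(Theta2 a (rightWeighted b s) n (star z))ᴴ -
      s 0 * denKreinEven a (rightWeighted b s) n z := by
    rw [Q2_eq, denKreinEven, Matrix.conjTranspose_sub, Matrix.conjTranspose_neg,
      Matrix.conjTranspose_smul, Matrix.conjTranspose_mul, h0, star_sub, star_star,
      Complex.star_def, Complex.conj_ofReal, mul_smul_comm]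
  rw [kreinOdd, denKreinOdd_eq hβ, Matrix.inv_smul' _ _ hdet, mul_smul_comm, hQ, sub_mul, neg_mul,
    Matrix.mul_nonsing_inv_cancel_right _ _ hdet, ← smul_neg, neg_sub, sub_neg_eq_add, kreinEven]

theorem exists_unit_eq_sub (hab : a ≤ b) (hz : z ∉ Complex.ofReal '' Set.Icc a b) :
    ∃ β : ℂˣ, (β : ℂ) = b - z :=
  ⟨Units.mk0 _ fun h => hz ⟨b, ⟨hab, le_rfl⟩, sub_eq_zero.1 h⟩, rfl⟩

theorem HausdorffPosDefEven.friedrichs (h : HausdorffPosDefEven a b s n) (hab : a < b)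
    (hz : z ∉ Complex.ofReal '' Set.Icc a b) :
    IsUnit (denFriedrichsEven b s n z) ∧ ContFracDefined (termsFriedrichsEven a b s n z) ∧
      friedrichsEven b s n z = contFrac (termsFriedrichsEven a b s n z) := by
  obtain ⟨β, hβ⟩ := exists_unit_eq_sub hab.le hz
  have h0 : (s 0)ᴴ = s 0 := h.isPosDefSeq.herm 0 (by omega)
  cases n with
  | zero =>
    have hden : denFriedrichsEven b s 0 z = β • 1 := by
      rw [denFriedrichsEven, Gamma1, Matrix.conjTranspose_one, Units.smul_def, hβ]
    refine ⟨hden ▸ isUnit_one.smul β, trivial, ?_⟩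
    rw [friedrichsEven, hden, Matrix.inv_smul' _ _ (by simp), inv_one, mul_smul_comm, mul_one,
      Theta1, h0, Units.smul_def, Units.val_inv_eq_inv_val, hβ]
    rfl
  | succ n =>
    obtain ⟨hunit, hdef, hval⟩ := h.rightWeighted.friedrichs hab hz
    have hs : IsPosDefSeq (THMM.rightWeighted b s) 1 :=
      (h.rightWeighted.isStieltjesPosDef hab).isPosDefSeq (by omega)
    rw [termsFriedrichsOdd_eq_cons] at hdef hval
    obtain ⟨hdef', hval'⟩ := contFrac_altSMul_cons (s 0) hdef β⁻¹
    rw [denFriedrichsEven_succ hβ, friedrichsEven_succ hβ h0 hunit,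
      termsFriedrichsEven_eq hs h0 hβ, hval, hval']
    exact ⟨hunit.smul β, hdef', rfl⟩

theorem HausdorffPosDefOdd.krein (h : HausdorffPosDefOdd a b s n) (hab : a < b)
    (hz : z ∉ Complex.ofReal '' Set.Icc a b) :
    IsUnit (denKreinOdd a b s n z) ∧ ContFracDefined (termsKreinOdd a b s n z) ∧
      kreinOdd a b s n z = contFrac (termsKreinOdd a b s n z) := by
  obtain ⟨β, hβ⟩ := exists_unit_eq_sub hab.le hz
  have h0 : (s 0)ᴴ = s 0 := (h.isStieltjesPosDef hab).herm 0 (by omega)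
  have hs : IsPosDefSeq (THMM.rightWeighted b s) 1 :=
    h.isPosDefSeq_rightWeighted.mono (by omega)
  obtain ⟨hunit, hdef, hval⟩ := h.rightWeighted.krein hab hz
  obtain ⟨hdef', hval'⟩ := contFrac_altSMul_cons (s 0) hdef β⁻¹
  rw [denKreinOdd_eq hβ, kreinOdd_eq hβ h0 hunit, termsKreinOdd_eq hs h0 hβ, hval, hval']
  exact ⟨hunit.smul β, hdef', rfl⟩

end EquivalenceTransformation

end THMM

end

theorem theorem6p2 (q n : ℕ) (a b : ℝ) (hab : a < b) (s : ℕ → Matrix (Fin q) (Fin q) ℂ) :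
    (THMM.HausdorffPosDefEven a b s n →
      ∀ z : ℂ, z ∉ Complex.ofReal '' Set.Icc a b →
        (IsUnit (THMM.denFriedrichsEven b s n z) ∧
          THMM.ContFracDefined (THMM.termsFriedrichsEven a b s n z) ∧
          THMM.friedrichsEven b s n z = THMM.contFrac (THMM.termsFriedrichsEven a b s n z)) ∧
        (IsUnit (THMM.denKreinEven a s n z) ∧
          THMM.ContFracDefined (THMM.termsKreinEven a s n z) ∧
          THMM.kreinEven a s n z = THMM.contFrac (THMM.termsKreinEven a s n z))) ∧
    (THMM.HausdorffPosDefOdd a b s n →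
      ∀ z : ℂ, z ∉ Complex.ofReal '' Set.Icc a b →
        (IsUnit (THMM.denFriedrichsOdd s n z) ∧
          THMM.ContFracDefined (THMM.termsFriedrichsOdd a s n z) ∧
          THMM.friedrichsOdd s n z = THMM.contFrac (THMM.termsFriedrichsOdd a s n z)) ∧
        (IsUnit (THMM.denKreinOdd a b s n z) ∧
          THMM.ContFracDefined (THMM.termsKreinOdd a b s n z) ∧
          THMM.kreinOdd a b s n z = THMM.contFrac (THMM.termsKreinOdd a b s n z))) :=
  ⟨fun h _ hz => ⟨h.friedrichs hab hz, h.krein hab hz⟩,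
    fun h _ hz => ⟨h.friedrichs hab hz, h.krein hab hz⟩⟩
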